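/- Let $\mu_0\in\mathcal P(\mathbb R^{d_0})$ and $\mu_1\in\mathcal P(\mathbb R^{d_1})$ be compactly supported Borel probability measures and let $\varepsilon>0$. For $A\in\mathbb R^{d_0\times d_1}$ let $$\mathsf{OT}_{A,\varepsilon}(\mu_0,\mu_1)=\inf_{\pi\in\Pi(\mu_0,\mu_1)}\int\left(-4\|x\|^2\|y\|^2-32\,x^{\intercal}Ay\right)d\pi(x,y)+\varepsilon\,\mathsf D_{\mathsf{KL}}(\pi\|\mu_0\otimes\mu_1),$$ where $\Pi(\mu_0,\mu_1)$ is the set of couplings of $\mu_0$ and $\mu_1$ and $\mathsf D_{\mathsf{KL}}$ is the Kullback–Leibler divergence, and let $\Phi(A)=32\|A\|_F^2+\mathsf{OT}_{A,\varepsilon}(\mu_0,\mu_1)$, where $\|\cdot\|_F$ is the Frobenius norm. Write $M_4(\mu)=\int\|x\|^4\,d\mu(x)$ and $\mathcal D_M=\{A\in\mathbb R^{d_0\times d_1}:\|A\|_F\le M/2\}$. Then $\Phi$ is real-valued and twice continuously differentiable on $\mathbb R^{d_0\times d_1}$, and: 1. $\Phi$ is weakly convex with parameter at most $\rho=32^2\varepsilon^{-1}\sqrt{M_4(\mu_0)M_4(\mu_1)}-64$,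 that is, $\Phi+\frac{\rho}{2}\|\cdot\|_F^2$ is convex on $\mathbb R^{d_0\times d_1}$ for this $\rho$ (which may be negative). 2. If $\sqrt{M_4(\mu_0)M_4(\mu_1)}<\varepsilon/16$, then $\Phi$ is strictly convex on $\mathbb R^{d_0\times d_1}$ and has a unique minimizer there. 3. For every $M>0$, $\Phi$ is $L$-smooth on $\mathcal D_M$, that is, $\|\nabla\Phi(A)-\nabla\Phi(B)\|_F\le L\|A-B\|_F$ for all $A,B\in\mathcal D_M$, with $$L=\max_{A\in\mathcal D_M}\ \lambda_{\max}\left(D^2\Phi_{[A]}\right)\vee\left(-\lambda_{\min}\left(D^2\Phi_{[A]}\right)\right)\ \le\ 64\vee\left(32^2\varepsilon^{-1}\sqrt{M_4(\mu_0)M_4(\mu_1)}-64\right),$$ where the maximum is attained and $\lambda_{\max}(D^2\Phi_{[A]})$, $\lambda_{\min}(D^2\Phi_{[A]})$ are the largest and smallest eigenvalues of the symmetric bilinear form $D^2\Phi_{[A]}$ (the Hessian of $\Phi$ at $A$) with respect to the Frobenius inner product. -/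

import Mathlib

open MeasureTheory InformationTheory Set

noncomputable section

/-- The space `ℝ^{d₀ × d₁}` of real matrices with the Frobenius inner product
`⟨A, B⟩_F = Tr(Aᵀ B) = ∑ i j, A (i, j) * B (i, j)` and the Frobenius norm. -/
abbrev FrobMatrix (d₀ d₁ : ℕ) : Type := EuclideanSpace ℝ (Fin d₀ × Fin d₁)

/-- The set `Π(μ₀, μ₁)` of couplings of `μ₀` and `μ₁`: the measures on the product with these
marginals. -/
def couplings {X Y : Type*} [MeasurableSpace X] [MeasurableSpace Y]
    (μ₀ : Measure X) (μ₁ : Measure Y) : Set (Measure (X × Y)) :=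
  {π | π.fst = μ₀ ∧ π.snd = μ₁}

/-- The entropic optimal transport problem with cost `c` and regularization parameter `ε`:
the infimum over all couplings `π` of `∫ c dπ + ε KL(π ‖ μ₀ ⊗ μ₁)`, as an extended real. -/
def entropicOT {X Y : Type*} [MeasurableSpace X] [MeasurableSpace Y]
    (c : X → Y → ℝ) (ε : ℝ) (μ₀ : Measure X) (μ₁ : Measure Y) : EReal :=
  ⨅ π ∈ couplings μ₀ μ₁,
    ((∫ z, c z.1 z.2 ∂π : ℝ) : EReal) + (ε : EReal) * (klDiv π (μ₀.prod μ₁) : EReal)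

/-- The cost `c_A(x, y) = -4 ‖x‖² ‖y‖² - 32 xᵀ A y`. -/
def costMatrix {d₀ d₁ : ℕ} (A : FrobMatrix d₀ d₁)
    (x : EuclideanSpace ℝ (Fin d₀)) (y : EuclideanSpace ℝ (Fin d₁)) : ℝ :=
  -4 * ‖x‖ ^ 2 * ‖y‖ ^ 2 - 32 * ∑ i, ∑ j, x i * A (i, j) * y j

/-- The problem `OT_{A,ε}(μ₀, μ₁)`: entropic optimal transport with cost `c_A`. -/
def matrixOT {d₀ d₁ : ℕ} (ε : ℝ) (μ₀ : Measure (EuclideanSpace ℝ (Fin d₀)))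
    (μ₁ : Measure (EuclideanSpace ℝ (Fin d₁))) (A : FrobMatrix d₀ d₁) : EReal :=
  entropicOT (costMatrix A) ε μ₀ μ₁

/-- The objective `Φ(A) = 32 ‖A‖_F² + OT_{A,ε}(μ₀, μ₁)`. -/
def objective {d₀ d₁ : ℕ} (ε : ℝ) (μ₀ : Measure (EuclideanSpace ℝ (Fin d₀)))
    (μ₁ : Measure (EuclideanSpace ℝ (Fin d₁))) (A : FrobMatrix d₀ d₁) : ℝ :=
  32 * ‖A‖ ^ 2 + (matrixOT ε μ₀ μ₁ A).toReal

/-- The fourth moment `M₄(μ) = ∫ ‖x‖⁴ dμ(x)`. -/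
def fourthMoment {d : ℕ} (μ : Measure (EuclideanSpace ℝ (Fin d))) : ℝ :=
  ∫ x, ‖x‖ ^ 4 ∂μ

/-- The ball `D_M = {A : ‖A‖_F ≤ M / 2}`. -/
def frobBall (d₀ d₁ : ℕ) (M : ℝ) : Set (FrobMatrix d₀ d₁) :=
  {A | ‖A‖ ≤ M / 2}

/-- `f` is `ρ`-weakly convex: `f + (ρ / 2) ‖·‖_F²` is convex. -/
def WeaklyConvex {d₀ d₁ : ℕ} (ρ : ℝ) (f : FrobMatrix d₀ d₁ → ℝ) : Prop :=
  ConvexOn ℝ univ (fun A => f A + ρ / 2 * ‖A‖ ^ 2)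

/-- `f` is `L`-smooth on `s`: it is differentiable at the points of `s` and its gradient is
`L`-Lipschitz on `s`, both for the Frobenius inner product. -/
def LSmoothOn {d₀ d₁ : ℕ} (L : ℝ) (f : FrobMatrix d₀ d₁ → ℝ) (s : Set (FrobMatrix d₀ d₁)) :
    Prop :=
  (∀ A ∈ s, DifferentiableAt ℝ f A) ∧
    ∀ A ∈ s, ∀ B ∈ s, ‖gradient f A - gradient f B‖ ≤ L * ‖A - B‖

/-- The second Fréchet derivative `D²f_[A](B, C)`. -/
def secondDeriv {d₀ d₁ : ℕ} (f : FrobMatrix d₀ d₁ → ℝ) (A B C : FrobMatrix d₀ d₁) : ℝ :=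
  fderiv ℝ (fderiv ℝ f) A B C

/-- The eigenvalues of the bilinear form `D²f_[A]` with respect to the Frobenius inner product,
i.e. the eigenvalues of the Hessian of `f` at `A`. -/
def hessianEigenvalues {d₀ d₁ : ℕ} (f : FrobMatrix d₀ d₁ → ℝ) (A : FrobMatrix d₀ d₁) : Set ℝ :=
  {l | ∃ B : FrobMatrix d₀ d₁, B ≠ 0 ∧ ∀ C, secondDeriv f A B C = l * inner ℝ B C}

/-- The largest eigenvalue of `D²f_[A]`. -/
def hessianMaxEigenvalue {d₀ d₁ : ℕ} (f : FrobMatrix d₀ d₁ → ℝ) (A : FrobMatrix d₀ d₁) : ℝ :=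
  sSup (hessianEigenvalues f A)

/-- The smallest eigenvalue of `D²f_[A]`. -/
def hessianMinEigenvalue {d₀ d₁ : ℕ} (f : FrobMatrix d₀ d₁ → ℝ) (A : FrobMatrix d₀ d₁) : ℝ :=
  sInf (hessianEigenvalues f A)

end

/-! Compact supports allow the cost to be replaced, without changing any coupling integral, by a
bounded continuous one: `costMatrix A` equals `-ε * a` on the supports, with the kernel `a =
clampedKernel ε hR A` affine in `A`. Entropic duality (`entropicOT_eq_dualValue`) then gives Φ(A) =
32‖A‖² + ε V(a), where V(a) = ∫φ dμ₀ + ∫ψ dμ₁ for any potentials (φ, ψ) solving the Schrödinger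
system with kernel a. Solutions exist because a Sinkhorn step contracts oscillation.

V is smooth on the Banach space of bounded continuous functions: the implicit function theorem
applies once the additive-constant freedom of the potentials is removed by a gauge term
(`bijective_linearized`, `contDiff_dualValue`).

The Hessian of V is never computed. If π is the optimal plan at a, then V(a) + 1 - ∫exp(w) dπ ≤ V(a
+ w) ≤ V(a) - ∫w dπ, with equality at w = 0, so comparing second derivatives along lines gives -∫w²
dπ ≤ D²V[w, w] ≤ 0. For w = 32ε⁻¹ xᵀBy, Cauchy–Schwarz and the marginals of π bound ∫w² dπ by
(32ε⁻¹)²‖B‖²√(M₄(μ₀)M₄(μ₁)). Hence -ρ‖B‖² ≤ D²Φ[B, B] ≤ 64‖B‖², and all three claims follow, with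
coercivity for the minimizer and the spectral theorem for L. -/

set_option linter.unusedSectionVars false

open scoped BoundedContinuousFunction

/-! ### Exponentials, direct sums and partial integrals of bounded continuous functions. -/

namespace BoundedContinuousFunction

variable {X Y : Type*} [TopologicalSpace X] [TopologicalSpace Y]

/-- Evaluation at a point is a continuous ring homomorphism, so it commutes with the exponential
series. Working with the Banach-algebra exponential makes its smoothness in `f` available. -/
lemma exp_apply (f : X →ᵇ ℝ) (x : X) : NormedSpace.exp f x = Real.exp (f x) := by
  have h : Continuous (fun g : X →ᵇ ℝ => g x) := continuous_eval_const x
  have := NormedSpace.map_exp (𝔸 := X →ᵇ ℝ) (𝔹 := ℝ)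
    ((Pi.evalRingHom (fun _ : X => ℝ) x).comp
      (BoundedContinuousFunction.toContinuousMapₐ ℝ (α := X) (γ := ℝ)
        |>.toRingHom |> (ContinuousMap.coeFnRingHom (α := X) (β := ℝ)).comp)) h f
  rw [Real.exp_eq_exp_ℝ]
  exact this

lemma coe_exp (f : X →ᵇ ℝ) : ⇑(NormedSpace.exp f) = fun x => Real.exp (f x) :=
  funext f.exp_apply

lemma abs_apply_le (f : X →ᵇ ℝ) (x : X) : |f x| ≤ ‖f‖ := f.norm_coe_le_norm x

/-- The function `(x, y) ↦ φ x + ψ y`, linear in the pair `(φ, ψ)`. -/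
noncomputable def directSum : (X →ᵇ ℝ) × (Y →ᵇ ℝ) →L[ℝ] (X × Y →ᵇ ℝ) :=
  (compContinuousCLM ℝ ℝ ⟨Prod.fst, continuous_fst⟩).coprod
    (compContinuousCLM ℝ ℝ ⟨Prod.snd, continuous_snd⟩)

@[simp]
lemma directSum_apply (p : (X →ᵇ ℝ) × (Y →ᵇ ℝ)) (z : X × Y) :
    directSum p z = p.1 z.1 + p.2 z.2 := rfl

variable [SecondCountableTopology X] [SecondCountableTopology Y]
  [MeasurableSpace X] [MeasurableSpace Y] [BorelSpace X] [BorelSpace Y]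

lemma integrable_slice (ν : Measure Y) [IsProbabilityMeasure ν] (h : X × Y →ᵇ ℝ) (x : X) :
    Integrable (fun y => h (x, y)) ν :=
  (h.compContinuous ⟨fun y => (x, y), by fun_prop⟩).integrable ν

/-- Integration of a bounded continuous function over the second variable. -/
noncomputable def integrateSnd (ν : Measure Y) [IsProbabilityMeasure ν] :
    (X × Y →ᵇ ℝ) →L[ℝ] (X →ᵇ ℝ) :=
  LinearMap.mkContinuous
    { toFun := fun h => BoundedContinuousFunction.ofNormedAddCommGroup
        (fun x => ∫ y, h (x, y) ∂ν)
        (continuous_of_dominated (bound := fun _ => ‖h‖)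
          (fun x => (integrable_slice ν h x).aestronglyMeasurable)
          (fun x => Filter.Eventually.of_forall fun y => h.norm_coe_le_norm _)
          (integrable_const _)
          (Filter.Eventually.of_forall fun y => by fun_prop)) ‖h‖
        (fun x => by
          simpa using norm_integral_le_of_norm_le_const (μ := ν)
            (Filter.Eventually.of_forall fun y => h.norm_coe_le_norm (x, y)))
      map_add' := fun f g => by
        ext x
        exact integral_add (integrable_slice ν f x) (integrable_slice ν g x)
      map_smul' := fun c f => by
        ext x
        exact integral_const_mul c _ } 1
    (fun h => by
      rw [one_mul, BoundedContinuousFunction.norm_le (norm_nonneg h)]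
      intro x
      simpa using norm_integral_le_of_norm_le_const (μ := ν)
        (Filter.Eventually.of_forall fun y => h.norm_coe_le_norm (x, y)))

@[simp]
lemma integrateSnd_apply (ν : Measure Y) [IsProbabilityMeasure ν] (h : X × Y →ᵇ ℝ) (x : X) :
    integrateSnd ν h x = ∫ y, h (x, y) ∂ν := rfl

/-- Integration of a bounded continuous function over the first variable. -/
noncomputable def integrateFst (μ : Measure X) [IsProbabilityMeasure μ] :
    (X × Y →ᵇ ℝ) →L[ℝ] (Y →ᵇ ℝ) :=
  (integrateSnd μ).comp (compContinuousCLM ℝ ℝ ⟨Prod.swap, continuous_swap⟩)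

@[simp]
lemma integrateFst_apply (μ : Measure X) [IsProbabilityMeasure μ] (h : X × Y →ᵇ ℝ) (y : Y) :
    integrateFst μ h y = ∫ x, h (x, y) ∂μ := rfl

/-- The mean of a bounded continuous function, as a continuous linear functional. -/
noncomputable def mean (μ : Measure X) [IsProbabilityMeasure μ] : (X →ᵇ ℝ) →L[ℝ] ℝ :=
  LinearMap.mkContinuous
    { toFun := fun h => ∫ x, h x ∂μ
      map_add' := fun f g => integral_add (f.integrable μ) (g.integrable μ)
      map_smul' := fun c f => integral_const_mul c _ } 1
    (fun h => by
      simpa using norm_integral_le_of_norm_le_const (μ := μ)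
        (Filter.Eventually.of_forall fun y => h.norm_coe_le_norm y))

@[simp]
lemma mean_apply (μ : Measure X) [IsProbabilityMeasure μ] (h : X →ᵇ ℝ) :
    mean μ h = ∫ x, h x ∂μ := rfl

end BoundedContinuousFunction

open BoundedContinuousFunction Filter Topology

/-! ### The soft-min transform and its contraction of oscillation. -/

section Schrodinger

variable {X Y : Type*} [TopologicalSpace X] [TopologicalSpace Y]
  [SecondCountableTopology X] [SecondCountableTopology Y]
  [MeasurableSpace X] [MeasurableSpace Y] [BorelSpace X] [BorelSpace Y]

/-- `(φ, ψ)` solves the Schrödinger system with log-kernel `a`: the measure with density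
`exp (φ x + ψ y + a (x, y))` with respect to `μ ⊗ ν` has marginals `μ` and `ν`. -/
structure IsSchrodingerPair (μ : Measure X) (ν : Measure Y) (a : X × Y →ᵇ ℝ)
    (φ : X →ᵇ ℝ) (ψ : Y →ᵇ ℝ) : Prop where
  integral_snd : ∀ x, ∫ y, Real.exp (φ x + ψ y + a (x, y)) ∂ν = 1
  integral_fst : ∀ y, ∫ x, Real.exp (φ x + ψ y + a (x, y)) ∂μ = 1

/-- The partition function `x ↦ ∫ exp (ψ y + a (x, y)) dν(y)`. -/
noncomputable def partitionFun (ν : Measure Y) [IsProbabilityMeasure ν] (a : X × Y →ᵇ ℝ)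
    (ψ : Y →ᵇ ℝ) : X →ᵇ ℝ :=
  integrateSnd ν (NormedSpace.exp (directSum (0, ψ) + a))

lemma partitionFun_apply (ν : Measure Y) [IsProbabilityMeasure ν] (a : X × Y →ᵇ ℝ)
    (ψ : Y →ᵇ ℝ) (x : X) :
    partitionFun ν a ψ x = ∫ y, Real.exp (ψ y + a (x, y)) ∂ν := by
  simp [partitionFun, exp_apply]

lemma integrable_exp_slice (ν : Measure Y) [IsProbabilityMeasure ν] (a : X × Y →ᵇ ℝ)
    (ψ : Y →ᵇ ℝ) (x : X) : Integrable (fun y => Real.exp (ψ y + a (x, y))) ν := by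
  have := integrable_slice ν (NormedSpace.exp (directSum (0, ψ) + a)) x
  simpa [exp_apply] using this

lemma exp_neg_le_partitionFun (ν : Measure Y) [IsProbabilityMeasure ν] (a : X × Y →ᵇ ℝ)
    (ψ : Y →ᵇ ℝ) (x : X) : Real.exp (-(‖ψ‖ + ‖a‖)) ≤ partitionFun ν a ψ x := by
  rw [partitionFun_apply]
  have := integral_mono (μ := ν) (integrable_const (Real.exp (-(‖ψ‖ + ‖a‖))))
    (integrable_exp_slice ν a ψ x) (fun y => by
      have h1 := neg_le_of_abs_le (ψ.abs_apply_le y)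
      have h2 := neg_le_of_abs_le (a.abs_apply_le (x, y))
      exact Real.exp_le_exp.2 (by linarith))
  simpa using this

lemma partitionFun_le_exp (ν : Measure Y) [IsProbabilityMeasure ν] (a : X × Y →ᵇ ℝ)
    (ψ : Y →ᵇ ℝ) (x : X) : partitionFun ν a ψ x ≤ Real.exp (‖ψ‖ + ‖a‖) := by
  rw [partitionFun_apply]
  have := integral_mono (μ := ν) (integrable_exp_slice ν a ψ x)
    (integrable_const (Real.exp (‖ψ‖ + ‖a‖))) (fun y => by
      have h1 := le_of_abs_le (ψ.abs_apply_le y)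
      have h2 := le_of_abs_le (a.abs_apply_le (x, y))
      exact Real.exp_le_exp.2 (by linarith))
  simpa using this

lemma partitionFun_pos (ν : Measure Y) [IsProbabilityMeasure ν] (a : X × Y →ᵇ ℝ)
    (ψ : Y →ᵇ ℝ) (x : X) : 0 < partitionFun ν a ψ x :=
  (Real.exp_pos _).trans_le (exp_neg_le_partitionFun ν a ψ x)

/-- The soft-min transform `x ↦ -log ∫ exp (ψ y + a (x, y)) dν(y)`. -/
noncomputable def softTransform (ν : Measure Y) [IsProbabilityMeasure ν] (a : X × Y →ᵇ ℝ)
    (ψ : Y →ᵇ ℝ) : X →ᵇ ℝ :=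
  BoundedContinuousFunction.ofNormedAddCommGroup
    (fun x => -Real.log (partitionFun ν a ψ x))
    ((partitionFun ν a ψ).continuous.log fun x => (partitionFun_pos ν a ψ x).ne').neg
    (‖ψ‖ + ‖a‖)
    (fun x => by
      rw [norm_neg, Real.norm_eq_abs, abs_le]
      exact ⟨(Real.le_log_iff_exp_le (partitionFun_pos ν a ψ x)).2
        (exp_neg_le_partitionFun ν a ψ x),
        (Real.log_le_iff_le_exp (partitionFun_pos ν a ψ x)).2 (partitionFun_le_exp ν a ψ x)⟩)

lemma softTransform_apply (ν : Measure Y) [IsProbabilityMeasure ν] (a : X × Y →ᵇ ℝ)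
    (ψ : Y →ᵇ ℝ) (x : X) : softTransform ν a ψ x = -Real.log (partitionFun ν a ψ x) := rfl

lemma integral_exp_softTransform (ν : Measure Y) [IsProbabilityMeasure ν] (a : X × Y →ᵇ ℝ)
    (ψ : Y →ᵇ ℝ) (x : X) :
    ∫ y, Real.exp (softTransform ν a ψ x + ψ y + a (x, y)) ∂ν = 1 := by
  have h : ∀ y, Real.exp (softTransform ν a ψ x + ψ y + a (x, y)) =
      (partitionFun ν a ψ x)⁻¹ * Real.exp (ψ y + a (x, y)) := fun y => by
    rw [softTransform_apply, add_assoc, Real.exp_add, Real.exp_neg,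
      Real.exp_log (partitionFun_pos ν a ψ x)]
  simp_rw [h]
  rw [integral_const_mul, ← partitionFun_apply, inv_mul_cancel₀ (partitionFun_pos ν a ψ x).ne']

lemma partitionFun_le_mul_partitionFun (ν : Measure Y) [IsProbabilityMeasure ν]
    (a : X × Y →ᵇ ℝ) (ψ : Y →ᵇ ℝ) (x x' : X) :
    partitionFun ν a ψ x ≤ Real.exp (2 * ‖a‖) * partitionFun ν a ψ x' := by
  rw [partitionFun_apply, partitionFun_apply, ← integral_const_mul]
  refine integral_mono (integrable_exp_slice ν a ψ x)
    ((integrable_exp_slice ν a ψ x').const_mul _) fun y => ?_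
  simp only
  rw [← Real.exp_add]
  have h1 := le_of_abs_le (a.abs_apply_le (x, y))
  have h2 := neg_le_of_abs_le (a.abs_apply_le (x', y))
  exact Real.exp_le_exp.2 (by linarith)

/-- The left side is exp(s)(1 - δ(1 - exp(-s))). Use 1 - exp(-s) ≥ s exp(-s) ≥ s exp(-s₀), then 1 -
u ≤ exp(-u). After taking logarithms this turns a mixture with weight δ into a linear contraction of
s. -/
lemma one_sub_mul_exp_add_le {δ s s₀ : ℝ} (hδ : 0 ≤ δ) (hs : 0 ≤ s) (hs₀ : s ≤ s₀) :
    (1 - δ) * Real.exp s + δ ≤ Real.exp ((1 - δ * Real.exp (-s₀)) * s) := by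
  have h1 : s * Real.exp (-s₀) ≤ 1 - Real.exp (-s) := by
    have h2 : s + 1 ≤ Real.exp s := Real.add_one_le_exp s
    have h3 : Real.exp (-s₀) ≤ Real.exp (-s) := Real.exp_le_exp.2 (by linarith)
    have h4 : Real.exp s * Real.exp (-s) = 1 := by rw [← Real.exp_add]; simp
    nlinarith [Real.exp_pos (-s), Real.exp_pos (-s₀)]
  have h5 : 1 - δ * (s * Real.exp (-s₀)) ≤ Real.exp (-(δ * (s * Real.exp (-s₀)))) := by
    linarith [Real.add_one_le_exp (-(δ * (s * Real.exp (-s₀))))]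
  have h6 : (1 - δ * Real.exp (-s₀)) * s = s + -(δ * (s * Real.exp (-s₀))) := by ring
  rw [h6, Real.exp_add]
  have h7 : (1 - δ) * Real.exp s + δ = Real.exp s * (1 - δ * (1 - Real.exp (-s))) := by
    have h4 : Real.exp s * Real.exp (-s) = 1 := by rw [← Real.exp_add]; simp
    linear_combination -δ * h4
  rw [h7]
  have h8 := mul_le_mul_of_nonneg_left h1 hδ
  exact mul_le_mul_of_nonneg_left (by linarith) (Real.exp_pos s).le

/-- The soft-min transform contracts the oscillation, by a factor which is uniform over
functions of bounded oscillation. -/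
lemma softTransform_sub_sub_le (ν : Measure Y) [IsProbabilityMeasure ν] (a : X × Y →ᵇ ℝ)
    {ψ₁ ψ₂ : Y →ᵇ ℝ} {s s₀ : ℝ} (hs : 0 ≤ s) (hs₀ : s ≤ s₀)
    (h : ∀ y y', (ψ₁ - ψ₂) y - (ψ₁ - ψ₂) y' ≤ s) (x x' : X) :
    (softTransform ν a ψ₁ - softTransform ν a ψ₂) x -
      (softTransform ν a ψ₁ - softTransform ν a ψ₂) x' ≤
      (1 - Real.exp (-(4 * ‖a‖)) * Real.exp (-s₀)) * s := by
  have : Nonempty Y := ν.nonempty_of_neZero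
  set M := ⨆ y, (ψ₁ - ψ₂) y with hM
  have hbdd : BddAbove (range fun y => (ψ₁ - ψ₂) y) :=
    ⟨‖ψ₁ - ψ₂‖, by rintro _ ⟨y, rfl⟩; exact le_of_abs_le (abs_apply_le _ y)⟩
  have hup : ∀ y, ψ₁ y ≤ M + ψ₂ y := fun y => by
    have := le_ciSup hbdd y
    simp only [BoundedContinuousFunction.sub_apply] at this
    simp only [hM, BoundedContinuousFunction.sub_apply]
    linarith
  have hlo : ∀ y, M - s + ψ₂ y ≤ ψ₁ y := fun y => by
    have h1 : M ≤ (ψ₁ - ψ₂) y + s := ciSup_le fun y' => by linarith [h y' y]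
    simp only [BoundedContinuousFunction.sub_apply] at h1
    linarith
  set δ := Real.exp (-(4 * ‖a‖)) with hδ
  have hδ2 : δ = Real.exp (-(2 * ‖a‖)) * Real.exp (-(2 * ‖a‖)) := by
    rw [← Real.exp_add, hδ]; ring_nf
  have hδ1 : δ ≤ 1 := Real.exp_le_one_iff.2 (by linarith [norm_nonneg a])
  have e2 : Real.exp (-(2 * ‖a‖)) * Real.exp (2 * ‖a‖) = 1 := by rw [← Real.exp_add]; simp
  -- Since M is the supremum of ψ₁ - ψ₂, the function exp(M + ψ₂) - exp(ψ₁) is nonnegative, so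
  -- replacing x by x' in the weight exp(a) costs at most a factor exp(2‖a‖).
  have key : Real.exp (-(2 * ‖a‖)) *
      (Real.exp M * partitionFun ν a ψ₂ x - partitionFun ν a ψ₁ x) ≤
      Real.exp M * partitionFun ν a ψ₂ x' - partitionFun ν a ψ₁ x' := by
    simp_rw [partitionFun_apply]
    rw [← integral_const_mul, ← integral_const_mul,
      ← integral_sub ((integrable_exp_slice ν a ψ₂ x).const_mul _) (integrable_exp_slice ν a ψ₁ x),
      ← integral_sub ((integrable_exp_slice ν a ψ₂ x').const_mul _)
        (integrable_exp_slice ν a ψ₁ x'), ← integral_const_mul]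
    refine integral_mono
      ((((integrable_exp_slice ν a ψ₂ x).const_mul _).sub
        (integrable_exp_slice ν a ψ₁ x)).const_mul _)
      (((integrable_exp_slice ν a ψ₂ x').const_mul _).sub (integrable_exp_slice ν a ψ₁ x'))
      fun y => ?_
    have e : ∀ z, Real.exp M * Real.exp (ψ₂ y + a (z, y)) - Real.exp (ψ₁ y + a (z, y)) =
        Real.exp (a (z, y)) * (Real.exp (M + ψ₂ y) - Real.exp (ψ₁ y)) := fun z => by
      simp only [Real.exp_add]; ring
    simp only [e]
    rw [← mul_assoc, ← Real.exp_add]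
    refine mul_le_mul_of_nonneg_right (Real.exp_le_exp.2 ?_)
      (sub_nonneg.2 (Real.exp_le_exp.2 (hup y)))
    have h1 := le_of_abs_le (a.abs_apply_le (x, y))
    have h2 := neg_le_of_abs_le (a.abs_apply_le (x', y))
    linarith
  have hlow : Real.exp (M - s) * partitionFun ν a ψ₂ x ≤ partitionFun ν a ψ₁ x := by
    simp_rw [partitionFun_apply]
    rw [← integral_const_mul]
    refine integral_mono ((integrable_exp_slice ν a ψ₂ x).const_mul _)
      (integrable_exp_slice ν a ψ₁ x) fun y => ?_
    simp only
    rw [← Real.exp_add]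
    exact Real.exp_le_exp.2 (by linarith [hlo y])
  have hD := partitionFun_le_mul_partitionFun ν a ψ₂ x' x
  have hupx : partitionFun ν a ψ₁ x ≤ Real.exp M * partitionFun ν a ψ₂ x := by
    simp_rw [partitionFun_apply]
    rw [← integral_const_mul]
    refine integral_mono (integrable_exp_slice ν a ψ₁ x)
      ((integrable_exp_slice ν a ψ₂ x).const_mul _) fun y => ?_
    simp only
    rw [← Real.exp_add]
    exact Real.exp_le_exp.2 (by linarith [hup y])
  have p1 := partitionFun_pos ν a ψ₁ x
  have p2 := partitionFun_pos ν a ψ₂ x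
  have p1' := partitionFun_pos ν a ψ₁ x'
  have p2' := partitionFun_pos ν a ψ₂ x'
  simp only [BoundedContinuousFunction.sub_apply, softTransform_apply]
  generalize partitionFun ν a ψ₁ x = N at *
  generalize partitionFun ν a ψ₂ x = D at *
  generalize partitionFun ν a ψ₁ x' = N' at *
  generalize partitionFun ν a ψ₂ x' = D' at *
  -- In terms of ratios, `t1` says exp(M) - N'/D' ≥ δ(exp(M) - N/D), where one factor exp(-2‖a‖) of
  -- δ comes from `key` and the other from `hD`; `t2` says exp(M) ≤ exp(s) N/D.
  have hmain : N' * D ≤ ((1 - δ) * Real.exp s + δ) * (N * D') := by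
    have t1 : δ * (Real.exp M * D - N) * D' ≤ (Real.exp M * D' - N') * D := by
      calc δ * (Real.exp M * D - N) * D'
          ≤ δ * (Real.exp M * D - N) * (Real.exp (2 * ‖a‖) * D) := by
            refine mul_le_mul_of_nonneg_left hD (mul_nonneg (Real.exp_pos _).le (by linarith))
        _ = Real.exp (-(2 * ‖a‖)) * (Real.exp M * D - N) * D := by
            rw [hδ2]
            linear_combination (Real.exp (-(2 * ‖a‖)) * (Real.exp M * D - N) * D) * e2
        _ ≤ _ := mul_le_mul_of_nonneg_right key p2.le
    have t2 : Real.exp M * D ≤ Real.exp s * N := by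
      have e3 : Real.exp s * Real.exp (M - s) = Real.exp M := by rw [← Real.exp_add]; ring_nf
      rw [← e3, mul_assoc]
      exact mul_le_mul_of_nonneg_left hlow (Real.exp_pos s).le
    have t3 := mul_le_mul_of_nonneg_left (mul_le_mul_of_nonneg_right t2 p2'.le)
      (sub_nonneg.2 hδ1)
    nlinarith
  have hfin := hmain.trans (mul_le_mul_of_nonneg_right
    (one_sub_mul_exp_add_le (Real.exp_pos _).le hs hs₀) (mul_pos p1 p2').le)
  have := Real.log_le_log (mul_pos p1' p2) hfin
  rw [Real.log_mul p1'.ne' p2.ne', Real.log_mul (Real.exp_pos _).ne' (mul_pos p1 p2').ne',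
    Real.log_exp, Real.log_mul p1.ne' p2'.ne'] at this
  linarith

end Schrodinger

/-! ### Existence of Schrödinger potentials by Sinkhorn iteration. -/

section Schrodinger

variable {X Y : Type*} [TopologicalSpace X] [TopologicalSpace Y]
  [SecondCountableTopology X] [SecondCountableTopology Y]
  [MeasurableSpace X] [MeasurableSpace Y] [BorelSpace X] [BorelSpace Y]

/-- One full step of the Sinkhorn iteration. -/
noncomputable def sinkhornStep (μ : Measure X) (ν : Measure Y) [IsProbabilityMeasure μ]
    [IsProbabilityMeasure ν] (a : X × Y →ᵇ ℝ) (φ : X →ᵇ ℝ) : X →ᵇ ℝ :=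
  softTransform ν a (softTransform μ (a.compContinuous ⟨Prod.swap, continuous_swap⟩) φ)

lemma sinkhornStep_sub_sub_le (μ : Measure X) (ν : Measure Y) [IsProbabilityMeasure μ]
    [IsProbabilityMeasure ν] (a : X × Y →ᵇ ℝ)
    {φ₁ φ₂ : X →ᵇ ℝ} {s s₀ : ℝ} (hs : 0 ≤ s) (hs₀ : s ≤ s₀)
    (h : ∀ y y', (φ₁ - φ₂) y - (φ₁ - φ₂) y' ≤ s) (x x' : X) :
    (sinkhornStep μ ν a φ₁ - sinkhornStep μ ν a φ₂) x -
      (sinkhornStep μ ν a φ₁ - sinkhornStep μ ν a φ₂) x' ≤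
      (1 - Real.exp (-(4 * ‖a‖)) * Real.exp (-s₀)) * s := by
  refine softTransform_sub_sub_le ν a hs hs₀ (fun y y' => ?_) x x'
  refine (softTransform_sub_sub_le μ _ hs hs₀ h y y').trans ?_
  -- Nonexpansiveness of the inner transform is enough; the contraction factor comes from the outer
  -- one alone.
  refine mul_le_of_le_one_left hs ?_
  have := mul_pos
    (Real.exp_pos (-(4 * ‖a.compContinuous ⟨Prod.swap, continuous_swap (X := Y) (Y := X)⟩‖)))
    (Real.exp_pos (-s₀))
  linarith

lemma exists_sinkhornStep_eq_add_const (μ : Measure X) (ν : Measure Y) [IsProbabilityMeasure μ]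
    [IsProbabilityMeasure ν] (a : X × Y →ᵇ ℝ) :
    ∃ (φ : X →ᵇ ℝ) (κ : ℝ), sinkhornStep μ ν a φ = φ + const X κ := by
  obtain ⟨x₀⟩ : Nonempty X := μ.nonempty_of_neZero
  -- Oscillation does not see constants. Normalizing the step to vanish at `x₀` makes the sup norm
  -- of a difference bounded by its oscillation, so contraction of oscillation yields convergence in
  -- norm.
  set T : (X →ᵇ ℝ) → (X →ᵇ ℝ) := fun φ =>
    sinkhornStep μ ν a φ - const X (sinkhornStep μ ν a φ x₀) with hT
  have hT_norm : ∀ (φ₁ φ₂ : X →ᵇ ℝ) {s s₀ : ℝ}, 0 ≤ s → s ≤ s₀ →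
      (∀ y y', (φ₁ - φ₂) y - (φ₁ - φ₂) y' ≤ s) →
      ‖T φ₁ - T φ₂‖ ≤ (1 - Real.exp (-(4 * ‖a‖)) * Real.exp (-s₀)) * s ∧
      ∀ x x', (T φ₁ - T φ₂) x - (T φ₁ - T φ₂) x' ≤
        (1 - Real.exp (-(4 * ‖a‖)) * Real.exp (-s₀)) * s := by
    intro φ₁ φ₂ s s₀ hs hs₀ h
    have key := sinkhornStep_sub_sub_le μ ν a hs hs₀ h
    simp only [BoundedContinuousFunction.sub_apply] at key
    refine ⟨(BoundedContinuousFunction.norm_le ((sub_self _).symm.le.trans (key x₀ x₀))).2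
      fun x => ?_, fun x x' => ?_⟩
    · rw [Real.norm_eq_abs, abs_le]
      simp only [hT, BoundedContinuousFunction.sub_apply, const_apply]
      constructor
      · linarith [key x₀ x]
      · linarith [key x x₀]
    · simp only [hT, BoundedContinuousFunction.sub_apply, const_apply]
      linarith [key x x']
  have hosc : ∀ (f : X →ᵇ ℝ) y y', f y - f y' ≤ 2 * ‖f‖ := fun f y y' => by
    have h1 := le_of_abs_le (f.abs_apply_le y)
    have h2 := neg_le_of_abs_le (f.abs_apply_le y')
    linarith
  have hcont : Continuous T := by
    refine (LipschitzWith.of_dist_le_mul (K := 2) fun φ₁ φ₂ => ?_).continuous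
    rw [dist_eq_norm, dist_eq_norm]
    have h0 : 0 ≤ 2 * ‖φ₁ - φ₂‖ := by positivity
    refine ((hT_norm φ₁ φ₂ h0 le_rfl (hosc _)).1).trans
      (mul_le_of_le_one_left h0 ?_)
    have := mul_pos (Real.exp_pos (-(4 * ‖a‖))) (Real.exp_pos (-(2 * ‖φ₁ - φ₂‖)))
    linarith
  set u : ℕ → (X →ᵇ ℝ) := fun n => T^[n] 0 with hu
  have hus : ∀ n, u (n + 1) = T (u n) := fun n => Function.iterate_succ_apply' T n 0
  -- The contraction factor depends on an a priori bound for the oscillation. This bounds the first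
  -- increment and, by induction, all later ones, so a single ratio r serves for the whole
  -- iteration.
  set s₀ := 2 * ‖u 1 - u 0‖ with hs₀
  set r := 1 - Real.exp (-(4 * ‖a‖)) * Real.exp (-s₀) with hr
  have hs₀0 : 0 ≤ s₀ := by positivity
  have hr0 : 0 ≤ r := by
    have h1 : Real.exp (-(4 * ‖a‖)) ≤ 1 := Real.exp_le_one_iff.2 (by linarith [norm_nonneg a])
    have h2 : Real.exp (-s₀) ≤ 1 := Real.exp_le_one_iff.2 (by linarith)
    have := mul_le_one₀ h1 (Real.exp_pos _).le h2
    linarith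
  have hr1 : r < 1 := by
    have := mul_pos (Real.exp_pos (-(4 * ‖a‖))) (Real.exp_pos (-s₀))
    linarith
  have hstep : ∀ n y y', (u (n + 1) - u n) y - (u (n + 1) - u n) y' ≤ s₀ * r ^ n := by
    intro n
    induction n with
    | zero => simpa using hosc (u 1 - u 0)
    | succ n ih =>
      have hp : s₀ * r ^ n ≤ s₀ := mul_le_of_le_one_right hs₀0 (pow_le_one₀ hr0 hr1.le)
      have := (hT_norm (u (n + 1)) (u n) (by positivity) hp ih).2
      rw [← hus, ← hus] at this
      intro y y'
      refine (this y y').trans (le_of_eq ?_)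
      rw [pow_succ]; ring
  have hdist : ∀ n, dist (u (n + 1)) (u (n + 1 + 1)) ≤ s₀ * r ^ n := by
    intro n
    have hp : s₀ * r ^ n ≤ s₀ := mul_le_of_le_one_right hs₀0 (pow_le_one₀ hr0 hr1.le)
    have := (hT_norm (u (n + 1)) (u n) (by positivity) hp (hstep n)).1
    rw [← hus, ← hus] at this
    rw [dist_comm, dist_eq_norm]
    exact this.trans (mul_le_of_le_one_left (by positivity) hr1.le)
  obtain ⟨φ, hφ⟩ := cauchySeq_tendsto_of_complete
    (cauchySeq_of_le_geometric r s₀ hr1 hdist)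
  have hφ' : Tendsto u atTop (𝓝 φ) := (tendsto_add_atTop_iff_nat 1).1 hφ
  have hfix : T φ = φ := by
    refine tendsto_nhds_unique ((hcont.tendsto φ).comp hφ') ?_
    simpa only [Function.comp_def, hus] using hφ
  refine ⟨φ, sinkhornStep μ ν a φ x₀, ?_⟩
  nth_rewrite 2 [← hfix]
  simp [hT]

theorem exists_isSchrodingerPair (μ : Measure X) (ν : Measure Y) [IsProbabilityMeasure μ]
    [IsProbabilityMeasure ν] (a : X × Y →ᵇ ℝ) :
    ∃ (φ : X →ᵇ ℝ) (ψ : Y →ᵇ ℝ), IsSchrodingerPair μ ν a φ ψ := by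
  obtain ⟨φ, κ, hφ⟩ := exists_sinkhornStep_eq_add_const μ ν a
  set ψ := softTransform μ (a.compContinuous ⟨Prod.swap, continuous_swap⟩) φ with hψ
  have h1 : ∀ y, ∫ x, Real.exp (φ x + ψ y + a (x, y)) ∂μ = 1 := fun y => by
    have := integral_exp_softTransform μ (a.compContinuous ⟨Prod.swap, continuous_swap⟩) φ y
    simpa [add_comm, add_left_comm, add_assoc] using this
  have h2 : ∀ x, ∫ y, Real.exp (φ x + ψ y + a (x, y)) ∂ν = Real.exp (-κ) := fun x => by
    have h := integral_exp_softTransform ν a ψ x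
    have e : softTransform ν a ψ x = φ x + κ := by
      have := congrArg (fun f : X →ᵇ ℝ => f x) hφ
      simpa [sinkhornStep] using this
    have e2 : ∀ y, Real.exp (φ x + ψ y + a (x, y)) =
        Real.exp (-κ) * Real.exp (softTransform ν a ψ x + ψ y + a (x, y)) := fun y => by
      rw [← Real.exp_add, e]; ring_nf
    simp_rw [e2]
    rw [integral_const_mul, h, mul_one]
  have hint : Integrable (fun z : X × Y => Real.exp (φ z.1 + ψ z.2 + a z)) (μ.prod ν) := by
    have := (NormedSpace.exp (directSum (φ, ψ) + a)).integrable (μ.prod ν)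
    simpa [coe_exp] using this
  -- The fixed point was found only up to a constant κ; computing the total mass in both orders of
  -- integration forces κ = 0.
  have h3 : Real.exp (-κ) = 1 := by
    have t1 := integral_prod _ hint
    have t2 := integral_prod_symm _ hint
    rw [t1] at t2
    simp only [h1, h2] at t2
    simpa using t2
  exact ⟨φ, ψ, fun x => (h2 x).trans h3, h1⟩

end Schrodinger

/-! ### Strong duality for entropic optimal transport with a bounded kernel. -/

section Duality

variable {X Y : Type*} [TopologicalSpace X] [TopologicalSpace Y]
  [SecondCountableTopology X] [SecondCountableTopology Y]
  [MeasurableSpace X] [MeasurableSpace Y] [BorelSpace X] [BorelSpace Y]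
  {μ : Measure X} {ν : Measure Y}

lemma isProbabilityMeasure_of_mem_couplings [IsProbabilityMeasure μ] {π : Measure (X × Y)}
    (hπ : π ∈ couplings μ ν) : IsProbabilityMeasure π := by
  refine ⟨?_⟩
  rw [← Measure.fst_univ, hπ.1, measure_univ]

lemma integral_fst_of_mem_couplings {π : Measure (X × Y)} (hπ : π ∈ couplings μ ν) {f : X → ℝ}
    (hf : Continuous f) : ∫ z, f z.1 ∂π = ∫ x, f x ∂μ := by
  rw [← hπ.1, Measure.fst, integral_map measurable_fst.aemeasurable
    hf.measurable.aestronglyMeasurable]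

lemma integral_snd_of_mem_couplings {π : Measure (X × Y)} (hπ : π ∈ couplings μ ν) {f : Y → ℝ}
    (hf : Continuous f) : ∫ z, f z.2 ∂π = ∫ y, f y ∂ν := by
  rw [← hπ.2, Measure.snd, integral_map measurable_snd.aemeasurable
    hf.measurable.aestronglyMeasurable]

lemma integral_directSum_of_mem_couplings [IsProbabilityMeasure μ] [IsProbabilityMeasure ν]
    {π : Measure (X × Y)} (hπ : π ∈ couplings μ ν) (φ : X →ᵇ ℝ) (ψ : Y →ᵇ ℝ) :
    ∫ z, directSum (φ, ψ) z ∂π = mean μ φ + mean ν ψ := by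
  have := isProbabilityMeasure_of_mem_couplings hπ
  simp only [directSum_apply, mean_apply]
  rw [integral_add, integral_fst_of_mem_couplings hπ φ.continuous,
    integral_snd_of_mem_couplings hπ ψ.continuous]
  · exact (φ.compContinuous ⟨Prod.fst, continuous_fst⟩).integrable π
  · exact (ψ.compContinuous ⟨Prod.snd, continuous_snd⟩).integrable π

lemma BoundedContinuousFunction.integrable_exp {Z : Type*} [TopologicalSpace Z]
    [MeasurableSpace Z] [OpensMeasurableSpace Z] (π : Measure Z) [IsFiniteMeasure π]
    (f : Z →ᵇ ℝ) : Integrable (fun z => Real.exp (f z)) π := by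
  have := (NormedSpace.exp f).integrable π
  rwa [coe_exp] at this

/-- The coupling of `μ` and `ν` with density `exp (φ x + ψ y + a (x, y))`. -/
noncomputable def schrodingerPlan (μ : Measure X) (ν : Measure Y) (a : X × Y →ᵇ ℝ)
    (φ : X →ᵇ ℝ) (ψ : Y →ᵇ ℝ) : Measure (X × Y) :=
  (μ.prod ν).tilted (directSum (φ, ψ) + a : X × Y →ᵇ ℝ)

namespace IsSchrodingerPair

variable [IsProbabilityMeasure μ] [IsProbabilityMeasure ν] {a : X × Y →ᵇ ℝ}
  {φ : X →ᵇ ℝ} {ψ : Y →ᵇ ℝ}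

lemma integral_exp (h : IsSchrodingerPair μ ν a φ ψ) :
    ∫ z, Real.exp ((directSum (φ, ψ) + a : X × Y →ᵇ ℝ) z) ∂(μ.prod ν) = 1 := by
  rw [integral_prod _ ((directSum (φ, ψ) + a).integrable_exp (μ.prod ν))]
  simp [h.integral_snd]

lemma isProbabilityMeasure_plan (_h : IsSchrodingerPair μ ν a φ ψ) :
    IsProbabilityMeasure (schrodingerPlan μ ν a φ ψ) :=
  isProbabilityMeasure_tilted (integrable_exp _ _)

lemma integral_plan (h : IsSchrodingerPair μ ν a φ ψ) (g : X × Y → ℝ) :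
    ∫ z, g z ∂(schrodingerPlan μ ν a φ ψ) =
      ∫ z, Real.exp ((directSum (φ, ψ) + a : X × Y →ᵇ ℝ) z) * g z ∂(μ.prod ν) := by
  rw [schrodingerPlan, integral_tilted, h.integral_exp]
  simp

lemma lintegral_plan (h : IsSchrodingerPair μ ν a φ ψ) (g : X × Y → ENNReal) :
    ∫⁻ z, g z ∂(schrodingerPlan μ ν a φ ψ) =
      ∫⁻ z, ENNReal.ofReal (Real.exp (φ z.1 + ψ z.2 + a z)) * g z ∂(μ.prod ν) := by
  rw [schrodingerPlan, lintegral_tilted, h.integral_exp]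
  simp

lemma plan_mem_couplings (h : IsSchrodingerPair μ ν a φ ψ) :
    schrodingerPlan μ ν a φ ψ ∈ couplings μ ν := by
  have hmeas : Measurable fun z : X × Y => ENNReal.ofReal (Real.exp (φ z.1 + ψ z.2 + a z)) := by
    have : Continuous fun z : X × Y => Real.exp (φ z.1 + ψ z.2 + a z) := by fun_prop
    exact this.measurable.ennreal_ofReal
  have hsnd : ∀ x, ∫⁻ y, ENNReal.ofReal (Real.exp (φ x + ψ y + a (x, y))) ∂ν = 1 := fun x => by
    rw [← ofReal_integral_eq_lintegral_ofReal, h.integral_snd, ENNReal.ofReal_one]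
    · simpa [coe_exp] using integrable_slice ν (NormedSpace.exp (directSum (φ, ψ) + a)) x
    · exact Eventually.of_forall fun y => (Real.exp_pos _).le
  have hfst : ∀ y, ∫⁻ x, ENNReal.ofReal (Real.exp (φ x + ψ y + a (x, y))) ∂μ = 1 := fun y => by
    rw [← ofReal_integral_eq_lintegral_ofReal, h.integral_fst, ENNReal.ofReal_one]
    · simpa [coe_exp] using integrable_slice μ
        ((NormedSpace.exp (directSum (φ, ψ) + a)).compContinuous ⟨Prod.swap, continuous_swap⟩) y
    · exact Eventually.of_forall fun y => (Real.exp_pos _).le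
  constructor
  · refine Measure.ext_of_lintegral _ fun f hf => ?_
    rw [Measure.fst, lintegral_map hf measurable_fst, h.lintegral_plan,
      lintegral_prod (fun z : X × Y => ENNReal.ofReal (Real.exp (φ z.1 + ψ z.2 + a z)) * f z.1)
        (hmeas.mul (hf.comp measurable_fst)).aemeasurable]
    refine lintegral_congr fun x => ?_
    refine (lintegral_mul_const (f x) (hmeas.comp (measurable_prodMk_left (x := x)))).trans ?_
    exact (congrArg (· * f x) (hsnd x)).trans (one_mul _)
  · refine Measure.ext_of_lintegral _ fun f hf => ?_
    rw [Measure.snd, lintegral_map hf measurable_snd, h.lintegral_plan,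
      lintegral_prod_symm
        (fun z : X × Y => ENNReal.ofReal (Real.exp (φ z.1 + ψ z.2 + a z)) * f z.2)
        (hmeas.mul (hf.comp measurable_snd)).aemeasurable]
    refine lintegral_congr fun y => ?_
    refine (lintegral_mul_const (f y) (hmeas.comp (measurable_prodMk_right (y := y)))).trans ?_
    exact (congrArg (· * f y) (hfst y)).trans (one_mul _)

lemma integral_exp_sub_plan (h : IsSchrodingerPair μ ν a φ ψ) (u : X × Y →ᵇ ℝ) :
    ∫ z, Real.exp ((u - (directSum (φ, ψ) + a) : X × Y →ᵇ ℝ) z) ∂(schrodingerPlan μ ν a φ ψ) =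
      ∫ z, Real.exp (u z) ∂(μ.prod ν) := by
  rw [h.integral_plan]
  refine integral_congr_ae (Eventually.of_forall fun z => ?_)
  simp only
  rw [← Real.exp_add]
  simp

/-- Tangent-line estimate for the exponential mass at a solution of the Schrödinger system. -/
lemma one_add_le_integral_exp (h : IsSchrodingerPair μ ν a φ ψ) (a' : X × Y →ᵇ ℝ)
    (φ' : X →ᵇ ℝ) (ψ' : Y →ᵇ ℝ) :
    1 + (mean μ φ' + mean ν ψ' - (mean μ φ + mean ν ψ)) +
        ∫ z, (a' - a) z ∂(schrodingerPlan μ ν a φ ψ) ≤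
      ∫ z, Real.exp ((directSum (φ', ψ') + a' : X × Y →ᵇ ℝ) z) ∂(μ.prod ν) := by
  have := h.isProbabilityMeasure_plan
  rw [← h.integral_exp_sub_plan (directSum (φ', ψ') + a'),
    ← integral_directSum_of_mem_couplings h.plan_mem_couplings φ' ψ',
    ← integral_directSum_of_mem_couplings h.plan_mem_couplings φ ψ]
  set π := schrodingerPlan μ ν a φ ψ
  have e : 1 + (mean π (directSum (φ', ψ')) - mean π (directSum (φ, ψ))) + mean π (a' - a) =
      mean π (1 + (directSum (φ', ψ') - directSum (φ, ψ)) + (a' - a)) := by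
    have h1 : mean π (1 : X × Y →ᵇ ℝ) = 1 := by simp
    simp only [map_add, map_sub, h1]
  -- The inequality 1 + t ≤ exp(t) is integrated against the plan, whose marginals turn the
  -- potentials into their means.
  refine e.le.trans (integral_mono (BoundedContinuousFunction.integrable _ _)
    (integrable_exp _ _) fun z => ?_)
  have := Real.add_one_le_exp ((directSum (φ', ψ') + a' - (directSum (φ, ψ) + a) :
    X × Y →ᵇ ℝ) z)
  refine le_trans (le_of_eq ?_) this
  simp
  ring

end IsSchrodingerPair

variable (μ ν) in
/-- The value of the dual problem with log-kernel `a`: the sum of the means of the potentials. -/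
noncomputable def dualValue [IsProbabilityMeasure μ] [IsProbabilityMeasure ν]
    (a : X × Y →ᵇ ℝ) : ℝ :=
  mean μ (exists_isSchrodingerPair μ ν a).choose +
    mean ν (exists_isSchrodingerPair μ ν a).choose_spec.choose

variable [IsProbabilityMeasure μ] [IsProbabilityMeasure ν] {a : X × Y →ᵇ ℝ}
  {φ : X →ᵇ ℝ} {ψ : Y →ᵇ ℝ}

lemma exists_isSchrodingerPair_dualValue (μ : Measure X) (ν : Measure Y) [IsProbabilityMeasure μ]
    [IsProbabilityMeasure ν] (a : X × Y →ᵇ ℝ) :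
    ∃ φ ψ, IsSchrodingerPair μ ν a φ ψ ∧ dualValue μ ν a = mean μ φ + mean ν ψ :=
  ⟨_, _, (exists_isSchrodingerPair μ ν a).choose_spec.choose_spec, rfl⟩

/-- Weak duality. -/
lemma mean_add_mean_le_dualValue (a : X × Y →ᵇ ℝ) (φ : X →ᵇ ℝ) (ψ : Y →ᵇ ℝ) :
    mean μ φ + mean ν ψ + 1 -
      ∫ z, Real.exp ((directSum (φ, ψ) + a : X × Y →ᵇ ℝ) z) ∂(μ.prod ν) ≤ dualValue μ ν a := by
  obtain ⟨φ₀, ψ₀, h, hv⟩ := exists_isSchrodingerPair_dualValue μ ν a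
  have := h.one_add_le_integral_exp a φ ψ
  simp only [sub_self, BoundedContinuousFunction.coe_zero, Pi.zero_apply, integral_zero] at this
  linarith

/-- Frees `dualValue` from the choice in its definition: the tangent-line estimate between two
solutions, used in both directions, equates their sums of means. -/
lemma IsSchrodingerPair.dualValue_eq (h : IsSchrodingerPair μ ν a φ ψ) :
    dualValue μ ν a = mean μ φ + mean ν ψ := by
  obtain ⟨φ₀, ψ₀, h₀, hv⟩ := exists_isSchrodingerPair_dualValue μ ν a
  have h1 := mean_add_mean_le_dualValue (μ := μ) (ν := ν) a φ ψ
  rw [h.integral_exp] at h1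
  have h2 := h.one_add_le_integral_exp a φ₀ ψ₀
  simp only [sub_self, BoundedContinuousFunction.coe_zero, Pi.zero_apply, integral_zero,
    h₀.integral_exp] at h2
  linarith

/-- Weak duality tested on the potentials (-‖a‖, 0), whose density is at most 1. Used for coercivity
of the objective. -/
lemma neg_norm_le_dualValue (a : X × Y →ᵇ ℝ) : -‖a‖ ≤ dualValue μ ν a := by
  have h := mean_add_mean_le_dualValue (μ := μ) (ν := ν) a (const X (-‖a‖)) 0
  have h2 : ∫ z, Real.exp ((directSum (const X (-‖a‖), 0) + a : X × Y →ᵇ ℝ) z) ∂(μ.prod ν) ≤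
      1 := by
    have := integral_mono (μ := μ.prod ν) (integrable_exp (μ.prod ν) _) (integrable_const (1 : ℝ))
      (f := fun z => Real.exp ((directSum (const X (-‖a‖), 0) + a : X × Y →ᵇ ℝ) z)) (fun z => by
        refine Real.exp_le_one_iff.2 ?_
        have := le_of_abs_le (a.abs_apply_le z)
        simp
        linarith)
    simpa using this
  simp only [mean_apply, const_apply, integral_const, probReal_univ, one_smul,
    BoundedContinuousFunction.coe_zero, Pi.zero_apply] at h
  linarith

/-- The plan at `a` gives an affine upper bound of the dual value. -/
lemma IsSchrodingerPair.dualValue_add_le (h : IsSchrodingerPair μ ν a φ ψ) (w : X × Y →ᵇ ℝ) :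
    dualValue μ ν (a + w) ≤ dualValue μ ν a - ∫ z, w z ∂(schrodingerPlan μ ν a φ ψ) := by
  obtain ⟨φ', ψ', h', hv'⟩ := exists_isSchrodingerPair_dualValue μ ν (a + w)
  have := h.one_add_le_integral_exp (a + w) φ' ψ'
  rw [h'.integral_exp, add_sub_cancel_left] at this
  rw [h.dualValue_eq, hv']
  linarith

/-- The potentials at `a` give a lower bound of the dual value. -/
lemma IsSchrodingerPair.le_dualValue_add (h : IsSchrodingerPair μ ν a φ ψ) (w : X × Y →ᵇ ℝ) :
    dualValue μ ν a + 1 - ∫ z, Real.exp (w z) ∂(schrodingerPlan μ ν a φ ψ) ≤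
      dualValue μ ν (a + w) := by
  have h1 := mean_add_mean_le_dualValue (μ := μ) (ν := ν) (a + w) φ ψ
  have h2 := h.integral_exp_sub_plan (directSum (φ, ψ) + (a + w))
  have e : directSum (φ, ψ) + (a + w) - (directSum (φ, ψ) + a) = w := by abel
  rw [e] at h2
  rw [h.dualValue_eq, h2]
  exact h1

/-- Gibbs variational principle: the difference of the two sides is the divergence of π from the
normalized tilted measure, hence nonnegative. -/
lemma integral_le_toReal_klDiv {u : X × Y →ᵇ ℝ} {π : Measure (X × Y)} [IsProbabilityMeasure π]
    (hu : ∫ z, Real.exp (u z) ∂(μ.prod ν) = 1) (hπ : klDiv π (μ.prod ν) ≠ ⊤) :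
    ∫ z, u z ∂π ≤ (klDiv π (μ.prod ν)).toReal := by
  obtain ⟨hac, hint⟩ := klDiv_ne_top_iff.1 hπ
  have hexp := u.integrable_exp (μ.prod ν)
  have := isProbabilityMeasure_tilted hexp
  have h1 := integral_llr_tilted_right hac (u.integrable π) hexp hint
  have h2 := integral_llr_add_sub_measure_univ_nonneg
    (hac.trans (absolutelyContinuous_tilted hexp))
    (integrable_llr_tilted_right hac (u.integrable π) hint hexp)
  rw [toReal_klDiv_of_measure_eq hac (by simp)]
  rw [hu, Real.log_one] at h1
  simp only [probReal_univ] at h2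
  linarith

/-- The equality case of the Gibbs principle: the log-density of the tilted measure is u itself. -/
lemma klDiv_tilted_left {u : X × Y →ᵇ ℝ} (hu : ∫ z, Real.exp (u z) ∂(μ.prod ν) = 1) :
    klDiv ((μ.prod ν).tilted u) (μ.prod ν) ≠ ⊤ ∧
      (klDiv ((μ.prod ν).tilted u) (μ.prod ν)).toReal = ∫ z, u z ∂((μ.prod ν).tilted u) := by
  have hexp := u.integrable_exp (μ.prod ν)
  have := isProbabilityMeasure_tilted hexp
  have hac := tilted_absolutelyContinuous (μ.prod ν) u
  have hllr : llr ((μ.prod ν).tilted u) (μ.prod ν) =ᵐ[(μ.prod ν).tilted u] u := by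
    filter_upwards [hac.ae_le (log_rnDeriv_tilted_left_self hexp)] with z hz
    rw [llr, hz, hu, Real.log_one, sub_zero]
  refine ⟨klDiv_ne_top hac ((integrable_congr hllr).2 (u.integrable _)), ?_⟩
  rw [toReal_klDiv_of_measure_eq hac (by simp), integral_congr_ae hllr]

/-- Strong duality for entropic optimal transport with a cost which agrees, on sets of full
measure, with a bounded continuous function. -/
theorem entropicOT_eq_dualValue {c : X → Y → ℝ} {ε : ℝ} (hε : 0 < ε) {S : Set X} {T : Set Y}
    (hS : ∀ᵐ x ∂μ, x ∈ S) (hT : ∀ᵐ y ∂ν, y ∈ T)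
    (hc : ∀ x ∈ S, ∀ y ∈ T, c x y = -ε * a (x, y)) :
    entropicOT c ε μ ν = ((ε * dualValue μ ν a : ℝ) : EReal) := by
  obtain ⟨φ, ψ, h, hv⟩ := exists_isSchrodingerPair_dualValue μ ν a
  have hcost : ∀ π ∈ couplings μ ν, ∫ z, c z.1 z.2 ∂π = -ε * ∫ z, a z ∂π := by
    intro π hπ
    rw [← integral_const_mul]
    have h1 : ∀ᵐ z ∂π, z.1 ∈ S := by
      rw [← hπ.1] at hS
      exact ae_of_ae_map measurable_fst.aemeasurable hS
    have h2 : ∀ᵐ z ∂π, z.2 ∈ T := by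
      rw [← hπ.2] at hT
      exact ae_of_ae_map measurable_snd.aemeasurable hT
    refine integral_congr_ae ?_
    filter_upwards [h1, h2] with z hz1 hz2 using hc _ hz1 _ hz2
  have hsum : ∀ π ∈ couplings μ ν, ∫ z, (directSum (φ, ψ) + a : X × Y →ᵇ ℝ) z ∂π =
      dualValue μ ν a + ∫ z, a z ∂π := by
    intro π hπ
    have := isProbabilityMeasure_of_mem_couplings hπ
    rw [hv, ← integral_directSum_of_mem_couplings hπ]
    exact integral_add ((directSum (φ, ψ)).integrable π) (a.integrable π)
  refine le_antisymm ?_ ?_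
  -- The Schrödinger plan is optimal: its divergence is V(a) + ∫a dπ, and the second term cancels
  -- the transport cost.
  · refine (iInf₂_le _ h.plan_mem_couplings).trans (le_of_eq ?_)
    obtain ⟨hk1, hk2⟩ := klDiv_tilted_left h.integral_exp
    rw [hcost _ h.plan_mem_couplings]
    change klDiv (schrodingerPlan μ ν a φ ψ) (μ.prod ν) ≠ ⊤ at hk1
    change (klDiv (schrodingerPlan μ ν a φ ψ) (μ.prod ν)).toReal =
      ∫ z, _ ∂(schrodingerPlan μ ν a φ ψ) at hk2
    rw [hsum _ h.plan_mem_couplings] at hk2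
    rw [← EReal.coe_ennreal_toReal hk1, hk2, ← EReal.coe_mul, ← EReal.coe_add]
    congr 1
    ring
  · refine le_iInf₂ fun π hπ => ?_
    have := isProbabilityMeasure_of_mem_couplings hπ
    rw [hcost π hπ]
    by_cases hk : klDiv π (μ.prod ν) = ⊤
    · rw [hk, EReal.coe_ennreal_top, EReal.coe_mul_top_of_pos hε, EReal.coe_add_top]
      exact le_top
    · have := integral_le_toReal_klDiv h.integral_exp hk
      rw [hsum π hπ] at this
      rw [← EReal.coe_ennreal_toReal hk, ← EReal.coe_mul, ← EReal.coe_add, EReal.coe_le_coe_iff]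
      nlinarith

end Duality

/-! ### Smoothness of the dual value by the implicit function theorem. -/

section Smoothness

variable {X Y : Type*} [TopologicalSpace X] [TopologicalSpace Y]
  [SecondCountableTopology X] [SecondCountableTopology Y]
  [MeasurableSpace X] [MeasurableSpace Y] [BorelSpace X] [BorelSpace Y]
  (μ : Measure X) (ν : Measure Y) [IsProbabilityMeasure μ] [IsProbabilityMeasure ν]

/-- The pair of marginal densities of a density on the product. -/
noncomputable def marginals : (X × Y →ᵇ ℝ) →L[ℝ] (X →ᵇ ℝ) × (Y →ᵇ ℝ) :=
  (integrateSnd ν).prod (integrateFst μ)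

/-- The exponent `(a, (φ, ψ)) ↦ φ x + ψ y + a (x, y)`. -/
noncomputable def exponent : (X × Y →ᵇ ℝ) × (X →ᵇ ℝ) × (Y →ᵇ ℝ) →L[ℝ] (X × Y →ᵇ ℝ) :=
  directSum.comp (.snd ℝ _ _) + .fst ℝ _ _

/-- The map `(φ, ψ) ↦ (δ ∫ φ dμ, 0)`, which breaks the translation invariance of the
Schrödinger system. -/
noncomputable def gaugeTerm (δ : ℝ) : (X →ᵇ ℝ) × (Y →ᵇ ℝ) →L[ℝ] (X →ᵇ ℝ) × (Y →ᵇ ℝ) :=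
  (ContinuousLinearMap.inl ℝ _ _).comp
    (((δ • mean μ).smulRight (1 : X →ᵇ ℝ)).comp (.fst ℝ _ _))

/-- The map whose level set through a solution describes the Schrödinger system. -/
noncomputable def schrodingerMap (δ : ℝ) (p : (X × Y →ᵇ ℝ) × (X →ᵇ ℝ) × (Y →ᵇ ℝ)) :
    (X →ᵇ ℝ) × (Y →ᵇ ℝ) :=
  marginals μ ν (NormedSpace.exp (exponent p)) + gaugeTerm μ δ p.2

lemma exponent_apply (p : (X × Y →ᵇ ℝ) × (X →ᵇ ℝ) × (Y →ᵇ ℝ)) :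
    exponent p = directSum p.2 + p.1 := rfl

lemma contDiff_schrodingerMap (δ : ℝ) {n : WithTop ℕ∞} :
    ContDiff ℝ n (schrodingerMap μ ν δ) := by
  have h : ContDiff ℝ n (NormedSpace.exp : (X × Y →ᵇ ℝ) → (X × Y →ᵇ ℝ)) :=
    contDiff_iff_contDiffAt.2 fun x => (NormedSpace.exp_analytic x).contDiffAt
  exact ((marginals μ ν).contDiff.comp (h.comp exponent.contDiff)).add
    ((gaugeTerm μ δ).contDiff.comp contDiff_snd)

lemma fderiv_schrodingerMap_inr (δ : ℝ) (p : (X × Y →ᵇ ℝ) × (X →ᵇ ℝ) × (Y →ᵇ ℝ))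
    (q : (X →ᵇ ℝ) × (Y →ᵇ ℝ)) :
    (fderiv ℝ (schrodingerMap μ ν δ) p ∘L .inr ℝ _ _) q =
      marginals μ ν (NormedSpace.exp (exponent p) * directSum q) + gaugeTerm μ δ q := by
  have h1 : HasFDerivAt (NormedSpace.exp : (X × Y →ᵇ ℝ) → (X × Y →ᵇ ℝ)) _ (exponent p) :=
    hasFDerivAt_exp (𝕂 := ℝ)
  have h2 := ((marginals μ ν).hasFDerivAt.comp p (h1.comp p exponent.hasFDerivAt)).add
    ((gaugeTerm (Y := Y) μ δ).hasFDerivAt.comp p hasFDerivAt_snd)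
  have h3 : fderiv ℝ (schrodingerMap μ ν δ) p = _ := h2.fderiv
  rw [h3]
  simp [exponent]

variable {μ ν}

/-- The linearized Schrödinger system with the gauge term is bijective. -/
lemma bijective_linearized {π : X × Y →ᵇ ℝ} {δ : ℝ} (hδ : 0 < δ) (hπ : ∀ z, δ ≤ π z)
    (h1 : ∀ x, ∫ y, π (x, y) ∂ν = 1) (h2 : ∀ y, ∫ x, π (x, y) ∂μ = 1) :
    Function.Bijective fun q : (X →ᵇ ℝ) × (Y →ᵇ ℝ) =>
      marginals μ ν (π * directSum q) + gaugeTerm μ δ q := by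
  have : Nonempty X := μ.nonempty_of_neZero
  have : Nonempty Y := ν.nonempty_of_neZero
  set K : (Y →ᵇ ℝ) →L[ℝ] (X →ᵇ ℝ) := (integrateSnd ν).comp
    ((ContinuousLinearMap.mul ℝ _ π).comp (directSum.comp (.inr ℝ _ _))) with hK
  set K' : (X →ᵇ ℝ) →L[ℝ] (Y →ᵇ ℝ) := (integrateFst μ).comp
    ((ContinuousLinearMap.mul ℝ _ π).comp (directSum.comp (.inl ℝ _ _))) with hK'
  have hK_apply : ∀ g x, K g x = ∫ y, π (x, y) * g y ∂ν := fun g x => by simp [hK]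
  have hK'_apply : ∀ f y, K' f y = ∫ x, π (x, y) * f x ∂μ := fun f y => by simp [hK']
  have hform : ∀ q : (X →ᵇ ℝ) × (Y →ᵇ ℝ), marginals μ ν (π * directSum q) + gaugeTerm μ δ q =
      (q.1 + K q.2 + (δ * mean μ q.1) • (1 : X →ᵇ ℝ), K' q.1 + q.2) := by
    rintro ⟨f, g⟩
    refine Prod.ext (BoundedContinuousFunction.ext fun x => ?_)
      (BoundedContinuousFunction.ext fun y => ?_)
    · have i1 : Integrable (fun y => π (x, y) * f x) ν := (integrable_slice ν π x).mul_const _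
      have i2 : Integrable (fun y => π (x, y) * g y) ν := 
        (integrable_slice ν (π * directSum (0, g)) x).congr (Eventually.of_forall fun y => by simp)
      simp [marginals, gaugeTerm, hK_apply, mul_add, integral_add i1 i2, integral_mul_const, h1]
    · have i1 : Integrable (fun x => π (x, y) * f x) μ := 
        (integrable_slice μ ((π * directSum (f, 0)).compContinuous
          ⟨Prod.swap, continuous_swap⟩) y).congr (Eventually.of_forall fun x => by simp)
      have i2 : Integrable (fun x => π (x, y) * g y) μ :=
        (integrable_slice μ (π.compContinuous ⟨Prod.swap, continuous_swap⟩) y).mul_const _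
      simp [marginals, gaugeTerm, hK'_apply, mul_add, integral_add i1 i2, integral_mul_const, h2]
  -- Eliminating the second unknown g = β - K'f from the system leaves (1 - R) f = α - Kβ, so it
  -- suffices to invert 1 - R.
  set R : (X →ᵇ ℝ) →L[ℝ] (X →ᵇ ℝ) :=
    K.comp K' - (δ • mean μ).smulRight (1 : X →ᵇ ℝ) with hR
  have hR_apply : ∀ f, R f = K (K' f) - (δ * mean μ f) • (1 : X →ᵇ ℝ) := fun f => by simp [hR]
  have hδ1 : δ ≤ 1 := by
    obtain ⟨x⟩ := ‹Nonempty X›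
    rw [← h1 x]
    simpa using integral_mono (integrable_const δ) (integrable_slice ν π x) fun y => hπ (x, y)
  have hK_one : K 1 = 1 := BoundedContinuousFunction.ext fun x => by
    simp [hK_apply, h1]
  have hK_norm : ∀ g, ‖K g‖ ≤ ‖g‖ := fun g => by
    refine (BoundedContinuousFunction.norm_le (norm_nonneg g)).2 fun x => ?_
    rw [hK_apply, ← one_mul ‖g‖, ← h1 x, ← integral_mul_const]
    refine norm_integral_le_of_norm_le ((integrable_slice ν π x).mul_const _)
      (Eventually.of_forall fun y => ?_)
    rw [norm_mul, Real.norm_of_nonneg (hδ.le.trans (hπ _))]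
    exact mul_le_mul_of_nonneg_left (g.norm_coe_le_norm _) (hδ.le.trans (hπ _))
  -- Doeblin minorization: removing δ from the Markov kernel leaves the nonnegative kernel π - δ of
  -- mass 1 - δ. This strict contraction is what the gauge term is for.
  have hK'_norm : ∀ f, ‖K' f - (δ * mean μ f) • (1 : Y →ᵇ ℝ)‖ ≤ (1 - δ) * ‖f‖ := fun f => by
    refine (BoundedContinuousFunction.norm_le
      (mul_nonneg (sub_nonneg.2 hδ1) (norm_nonneg f))).2 fun y => ?_
    have i0 := integrable_slice μ (π.compContinuous ⟨Prod.swap, continuous_swap⟩) y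
    have i0' : Integrable (fun x => π (x, y)) μ := i0
    have i1 : Integrable (fun x => π (x, y) * f x) μ := 
      (integrable_slice μ ((π * directSum (f, 0)).compContinuous
        ⟨Prod.swap, continuous_swap⟩) y).congr (Eventually.of_forall fun x => by simp)
    have e1 : (K' f - (δ * mean μ f) • (1 : Y →ᵇ ℝ)) y = ∫ x, (π (x, y) - δ) * f x ∂μ := by
      simp only [sub_mul]
      rw [integral_sub i1 ((f.integrable μ).const_mul δ), integral_const_mul]
      simp [hK'_apply]
    have e2 : 1 - δ = ∫ x, (π (x, y) - δ) ∂μ := by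
      rw [integral_sub i0' (integrable_const _), h2]
      simp
    rw [e1, e2, ← integral_mul_const]
    refine norm_integral_le_of_norm_le ((i0'.sub (integrable_const _)).mul_const _)
      (Eventually.of_forall fun x => ?_)
    rw [norm_mul, Real.norm_of_nonneg (sub_nonneg.2 (hπ _))]
    exact mul_le_mul_of_nonneg_left (f.norm_coe_le_norm _) (sub_nonneg.2 (hπ _))
  have hR_norm : ‖R‖ < 1 := by
    refine lt_of_le_of_lt (R.opNorm_le_bound (sub_nonneg.2 hδ1) fun f => ?_)
      (show 1 - δ < 1 by linarith)
    -- Because K fixes constants, the rank-one gauge term can be moved inside K.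
    have e : R f = K (K' f - (δ * mean μ f) • (1 : Y →ᵇ ℝ)) := by
      rw [hR_apply, map_sub, map_smul, hK_one]
    rw [e]
    exact (hK_norm _).trans (hK'_norm f)
  obtain ⟨U, hU⟩ := isUnit_one_sub_of_norm_lt_one (R := (X →ᵇ ℝ) →L[ℝ] (X →ᵇ ℝ)) hR_norm
  have hU1 : ∀ f, (↑U⁻¹ : (X →ᵇ ℝ) →L[ℝ] (X →ᵇ ℝ)) (f - R f) = f := fun f => by
    have := congrArg (fun A : (X →ᵇ ℝ) →L[ℝ] (X →ᵇ ℝ) => A f) U.inv_mul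
    simpa [hU] using this
  have hU2 : ∀ f, (↑U⁻¹ : (X →ᵇ ℝ) →L[ℝ] (X →ᵇ ℝ)) f -
      R ((↑U⁻¹ : (X →ᵇ ℝ) →L[ℝ] (X →ᵇ ℝ)) f) = f := fun f => by
    have := congrArg (fun A : (X →ᵇ ℝ) →L[ℝ] (X →ᵇ ℝ) => A f) U.mul_inv
    simpa [hU] using this
  simp only [hform]
  constructor
  · have hinj : ∀ (q : (X →ᵇ ℝ) × (Y →ᵇ ℝ)) (r : (X →ᵇ ℝ) × (Y →ᵇ ℝ)),
        (q.1 + K q.2 + (δ * mean μ q.1) • (1 : X →ᵇ ℝ), K' q.1 + q.2) = r →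
        q.1 = (↑U⁻¹ : (X →ᵇ ℝ) →L[ℝ] (X →ᵇ ℝ)) (r.1 - K r.2) ∧ q.2 = r.2 - K' q.1 := by
      rintro q r rfl
      refine ⟨?_, by simp⟩
      refine (hU1 q.1).symm.trans (congrArg _ ?_)
      simp only [hR_apply, map_add]
      abel
    intro q q' hq
    obtain ⟨a1, a2⟩ := hinj q _ rfl
    obtain ⟨b1, b2⟩ := hinj q' _ hq.symm
    have e := a1.trans b1.symm
    refine Prod.ext e ?_
    rw [a2, b2, e]
    simp only [e]
  · rintro ⟨α, β⟩
    refine ⟨((↑U⁻¹ : (X →ᵇ ℝ) →L[ℝ] (X →ᵇ ℝ)) (α - K β),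
      β - K' ((↑U⁻¹ : (X →ᵇ ℝ) →L[ℝ] (X →ᵇ ℝ)) (α - K β))), ?_⟩
    have := hU2 (α - K β)
    rw [hR_apply] at this
    refine Prod.ext ?_ (by simp)
    simp only [map_sub] at this ⊢
    linear_combination (exp := 1) this

/-- The gauge term can only shift the first marginal density by a constant; since the second
marginal fixes the total mass at 1, Fubini makes that constant zero. -/
lemma isSchrodingerPair_of_schrodingerMap_eq {δ : ℝ}
    {a₀ a : X × Y →ᵇ ℝ} {φ₀ φ : X →ᵇ ℝ} {ψ₀ ψ : Y →ᵇ ℝ}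
    (h₀ : IsSchrodingerPair μ ν a₀ φ₀ ψ₀)
    (h : schrodingerMap μ ν δ (a, φ, ψ) = schrodingerMap μ ν δ (a₀, φ₀, ψ₀)) :
    IsSchrodingerPair μ ν a φ ψ := by
  have e1 : ∀ x, ∫ y, Real.exp (φ x + ψ y + a (x, y)) ∂ν =
      1 + (δ * mean μ φ₀ - δ * mean μ φ) := fun x => by
    have := congrArg (fun q : (X →ᵇ ℝ) × (Y →ᵇ ℝ) => q.1 x) h
    simp [schrodingerMap, marginals, gaugeTerm, exponent_apply, exp_apply, h₀.integral_snd] at this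
    simp
    linarith
  have e2 : ∀ y, ∫ x, Real.exp (φ x + ψ y + a (x, y)) ∂μ = 1 := fun y => by
    have := congrArg (fun q : (X →ᵇ ℝ) × (Y →ᵇ ℝ) => q.2 y) h
    simp [schrodingerMap, marginals, gaugeTerm, exponent_apply, exp_apply, h₀.integral_fst] at this
    exact this
  have hint : Integrable (fun z : X × Y => Real.exp (φ z.1 + ψ z.2 + a z)) (μ.prod ν) :=
    (directSum (φ, ψ) + a).integrable_exp (μ.prod ν)
  have t1 := integral_prod _ hint
  have t2 := integral_prod_symm _ hint
  rw [t1] at t2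
  simp only [e1, e2] at t2
  simp only [integral_const, probReal_univ, one_smul] at t2
  exact ⟨fun x => (e1 x).trans t2, e2⟩

-- The implicit function supplies, near each kernel, Schrödinger pairs depending smoothly on the
-- kernel, and the dual value is a continuous linear function of the pair.
variable (μ ν) in
theorem contDiff_dualValue {n : ℕ} (hn : n ≠ 0) : ContDiff ℝ n (dualValue μ ν) := by
  refine contDiff_iff_contDiffAt.2 fun a => ?_
  obtain ⟨φ, ψ, h⟩ := exists_isSchrodingerPair μ ν a
  set p : (X × Y →ᵇ ℝ) × (X →ᵇ ℝ) × (Y →ᵇ ℝ) := (a, φ, ψ) with hp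
  -- A uniform positive lower bound for the density of the plan, as `bijective_linearized` requires.
  set δ := Real.exp (-‖exponent p‖) 
  have cdf : ContDiffAt ℝ n (schrodingerMap μ ν δ) p := (contDiff_schrodingerMap μ ν δ).contDiffAt
  have hbij : Function.Bijective
      (fderiv ℝ (schrodingerMap μ ν δ) p ∘L .inr ℝ (X × Y →ᵇ ℝ) ((X →ᵇ ℝ) × (Y →ᵇ ℝ))) := by
    have e := funext (fderiv_schrodingerMap_inr μ ν δ p)
    rw [e]
    refine bijective_linearized (Real.exp_pos _) (fun z => ?_) (fun x => ?_) fun y => ?_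
    · rw [exp_apply]
      exact Real.exp_le_exp.2 (neg_le_of_abs_le (abs_apply_le _ z))
    · simpa [exp_apply, exponent_apply, hp] using h.integral_snd x
    · simpa [exp_apply, exponent_apply, hp] using h.integral_fst y
  have hinv : (fderiv ℝ (schrodingerMap μ ν δ) p ∘L
      .inr ℝ (X × Y →ᵇ ℝ) ((X →ᵇ ℝ) × (Y →ᵇ ℝ))).IsInvertible :=
    ⟨ContinuousLinearEquiv.ofBijective _ (LinearMap.ker_eq_bot.2 hbij.1)
      (LinearMap.range_eq_top.2 hbij.2), ContinuousLinearEquiv.coe_ofBijective _ _ _⟩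
  have hn' : (n : WithTop ℕ∞) ≠ 0 := by exact_mod_cast hn
  have hsmooth := cdf.contDiffAt_implicitFunction hn' hinv
  have hsol := cdf.eventually_apply_implicitFunction hn' hinv
  set s := cdf.implicitFunction hn' hinv
  have hs : ContDiffAt ℝ n (fun b => mean μ (s b).1 + mean ν (s b).2) a :=
    ((mean μ).contDiff.contDiffAt.comp a (contDiffAt_fst.comp a hsmooth)).add
      ((mean ν).contDiff.contDiffAt.comp a (contDiffAt_snd.comp a hsmooth))
  refine hs.congr_of_eventuallyEq ?_
  filter_upwards [hsol] with b hb
  exact (isSchrodingerPair_of_schrodingerMap_eq h hb).dualValue_eq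

end Smoothness

/-! ### Derivatives along lines and second-order conditions. -/

section LineDerivatives

/-- Second-order necessary condition for a local minimum. -/
lemma IsLocalMin.second_deriv_nonneg {h h' : ℝ → ℝ} {c t₀ : ℝ} (hmin : IsLocalMin h t₀)
    (h1 : ∀ t, HasDerivAt h (h' t) t) (h2 : HasDerivAt h' c t₀) : 0 ≤ c := by
  have e1 : deriv h = h' := funext fun t => (h1 t).deriv
  have e2 : deriv (deriv h) t₀ = c := by rw [e1, h2.deriv]
  by_contra! hc
  -- If c < 0, the point is also a local maximum, so h is locally constant and its second derivative
  -- vanishes there.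
  have hmax := isLocalMax_of_deriv_deriv_neg (by rw [e2]; exact hc) hmin.deriv_eq_zero
    (h1 t₀).continuousAt
  have hconst : h =ᶠ[𝓝 t₀] fun _ => h t₀ := by
    filter_upwards [hmin, hmax] with t a b using le_antisymm b a
  have : deriv (deriv h) t₀ = 0 := by
    rw [hconst.deriv.deriv_eq]
    simp
  linarith

variable {E : Type*} [NormedAddCommGroup E] [NormedSpace ℝ E]

lemma ContDiff.hasDerivAt_line {f : E → ℝ} (hf : ContDiff ℝ 2 f) (x v : E) (t : ℝ) :
    HasDerivAt (fun t : ℝ => f (x + t • v)) (fderiv ℝ f (x + t • v) v) t := by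
  have h1 : HasDerivAt (fun t : ℝ => x + t • v) v t := by
    simpa using ((hasDerivAt_id t).smul_const v).const_add x
  exact ((hf.differentiable (by norm_num)) _).hasFDerivAt.comp_hasDerivAt t h1

lemma ContDiff.hasDerivAt_fderiv_line {f : E → ℝ} (hf : ContDiff ℝ 2 f) (x v : E) (t : ℝ) :
    HasDerivAt (fun t : ℝ => fderiv ℝ f (x + t • v) v)
      (fderiv ℝ (fderiv ℝ f) (x + t • v) v v) t := by
  have h1 : HasDerivAt (fun t : ℝ => x + t • v) v t := by
    simpa using ((hasDerivAt_id t).smul_const v).const_add x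
  have h2 : ContDiff ℝ 1 (fderiv ℝ f) := hf.fderiv_right (by norm_num)
  have h3 := ((h2.differentiable (by norm_num)) (x + t • v)).hasFDerivAt.comp_hasDerivAt t h1
  exact h3.clm_apply (hasDerivAt_const t v) |>.congr_deriv (by simp)

/-- A function whose restrictions to all lines have nonnegative second derivatives is convex. -/
lemma convexOn_univ_of_line_deriv2_nonneg {f : E → ℝ} {D₁ D₂ : E → E → ℝ}
    (h1 : ∀ x v (t : ℝ), HasDerivAt (fun t : ℝ => f (x + t • v)) (D₁ (x + t • v) v) t)
    (h2 : ∀ x v (t : ℝ), HasDerivAt (fun t : ℝ => D₁ (x + t • v) v) (D₂ (x + t • v) v) t)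
    (h3 : ∀ x v, 0 ≤ D₂ x v) : ConvexOn ℝ univ f := by
  refine ⟨convex_univ, fun x _ y _ a b ha hb hab => ?_⟩
  have hg : ConvexOn ℝ univ (fun t : ℝ => f (x + t • (y - x))) := by
    have e1 := funext fun t => (h1 x (y - x) t).deriv
    refine convexOn_univ_of_deriv2_nonneg (fun t => (h1 x (y - x) t).differentiableAt)
      (fun t => ?_) fun t => ?_
    · rw [e1]
      exact (h2 x (y - x) t).differentiableAt
    · simp only [Function.iterate_succ, Function.iterate_zero, Function.comp_apply, id_eq]
      rw [e1, (h2 x (y - x) t).deriv]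
      exact h3 _ _
  have := hg.2 (mem_univ 0) (mem_univ 1) ha hb hab
  simp only [smul_eq_mul, mul_zero, mul_one, zero_add, zero_smul, add_zero, one_smul,
    add_sub_cancel] at this
  have e : a • x + b • y = x + b • (y - x) := by
    rw [smul_sub, eq_sub_of_add_eq hab, sub_smul, one_smul]
    abel
  rw [e]
  exact this

end LineDerivatives

section NormSq

variable {E : Type*} [NormedAddCommGroup E] [InnerProductSpace ℝ E]

lemma hasDerivAt_norm_sq_line (x v : E) (t : ℝ) :
    HasDerivAt (fun t : ℝ => ‖x + t • v‖ ^ 2) (2 * inner ℝ (x + t • v) v) t := by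
  have h1 : HasDerivAt (fun t : ℝ => x + t • v) v t := by
    simpa using ((hasDerivAt_id t).smul_const v).const_add x
  exact h1.norm_sq

lemma hasDerivAt_inner_line (x v : E) (t : ℝ) :
    HasDerivAt (fun t : ℝ => 2 * inner ℝ (x + t • v) v) (2 * ‖v‖ ^ 2) t := by
  have h1 : HasDerivAt (fun t : ℝ => x + t • v) v t := by
    simpa using ((hasDerivAt_id t).smul_const v).const_add x
  have h2 := (h1.inner ℝ (hasDerivAt_const t v)).const_mul 2
  refine h2.congr_deriv ?_
  simp

end NormSq

/-! ### Two-sided bounds for the second derivative of the dual value. -/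

section SecondOrder

variable {Z : Type*} [TopologicalSpace Z] [MeasurableSpace Z] [OpensMeasurableSpace Z]

lemma mem_interior_integrableExpSet (π : Measure Z) [IsFiniteMeasure π] (w : Z →ᵇ ℝ) (t : ℝ) :
    t ∈ interior (ProbabilityTheory.integrableExpSet w π) := by
  have : ProbabilityTheory.integrableExpSet w π = univ :=
    eq_univ_of_forall fun s => (s • w).integrable_exp π
  simp [this]

lemma hasDerivAt_integral_exp (π : Measure Z) [IsFiniteMeasure π] (w : Z →ᵇ ℝ) (t : ℝ) :
    HasDerivAt (fun t : ℝ => ∫ z, Real.exp (t * w z) ∂π)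
      (∫ z, w z * Real.exp (t * w z) ∂π) t :=
  ProbabilityTheory.hasDerivAt_mgf (mem_interior_integrableExpSet π w t)

lemma hasDerivAt_integral_mul_exp (π : Measure Z) [IsFiniteMeasure π] (w : Z →ᵇ ℝ) (t : ℝ) :
    HasDerivAt (fun t : ℝ => ∫ z, w z * Real.exp (t * w z) ∂π)
      (∫ z, w z ^ 2 * Real.exp (t * w z) ∂π) t := by
  simpa using ProbabilityTheory.hasDerivAt_integral_pow_mul_exp_real
    (mem_interior_integrableExpSet π w t) 1

variable {X Y : Type*} [TopologicalSpace X] [TopologicalSpace Y]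
  [SecondCountableTopology X] [SecondCountableTopology Y]
  [MeasurableSpace X] [MeasurableSpace Y] [BorelSpace X] [BorelSpace Y]
  {μ : Measure X} {ν : Measure Y} [IsProbabilityMeasure μ] [IsProbabilityMeasure ν]
  {a : X × Y →ᵇ ℝ} {φ : X →ᵇ ℝ} {ψ : Y →ᵇ ℝ}

/-- The affine upper bound `dualValue_add_le` touches the dual value at w = 0, so along each line
their difference has a minimum there. -/
lemma IsSchrodingerPair.second_fderiv_dualValue_nonpos (h : IsSchrodingerPair μ ν a φ ψ)
    (w : X × Y →ᵇ ℝ) : fderiv ℝ (fderiv ℝ (dualValue μ ν)) a w w ≤ 0 := by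
  have hC : ContDiff ℝ 2 (dualValue μ ν) := contDiff_dualValue μ ν (n := 2) (by norm_num)
  have hmin : IsLocalMin (fun t : ℝ => -t * ∫ z, w z ∂(schrodingerPlan μ ν a φ ψ) -
      dualValue μ ν (a + t • w)) 0 := Eventually.of_forall fun t => by
    have := h.dualValue_add_le (t • w)
    simp only [BoundedContinuousFunction.coe_smul, smul_eq_mul] at this
    rw [integral_const_mul] at this
    simp only [neg_zero, zero_mul, zero_smul, add_zero]
    linarith
  have h1 : ∀ t : ℝ, HasDerivAt (fun t : ℝ => -t * ∫ z, w z ∂(schrodingerPlan μ ν a φ ψ))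
      (-1 * ∫ z, w z ∂(schrodingerPlan μ ν a φ ψ)) t := fun t =>
    ((hasDerivAt_id t).neg).mul_const _
  have := hmin.second_deriv_nonneg (fun t => (h1 t).sub (hC.hasDerivAt_line a w t))
    ((hasDerivAt_const _ _).sub (hC.hasDerivAt_fderiv_line a w 0))
  simpa using this

/-- The lower bound `le_dualValue_add` also touches at w = 0, and ∫exp(tw) dπ has second derivative
∫w² dπ at t = 0. -/
lemma IsSchrodingerPair.neg_integral_sq_le_second_fderiv_dualValue
    (h : IsSchrodingerPair μ ν a φ ψ) (w : X × Y →ᵇ ℝ) :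
    -∫ z, w z ^ 2 ∂(schrodingerPlan μ ν a φ ψ) ≤
      fderiv ℝ (fderiv ℝ (dualValue μ ν)) a w w := by
  have := h.isProbabilityMeasure_plan
  have hC : ContDiff ℝ 2 (dualValue μ ν) := contDiff_dualValue μ ν (n := 2) (by norm_num)
  have hmin : IsLocalMin (fun t : ℝ => dualValue μ ν (a + t • w) +
      ∫ z, Real.exp (t * w z) ∂(schrodingerPlan μ ν a φ ψ)) 0 := Eventually.of_forall fun t => by
    have := h.le_dualValue_add (t • w)
    simp only [BoundedContinuousFunction.coe_smul, smul_eq_mul] at this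
    simp only [zero_smul, add_zero, zero_mul, Real.exp_zero, integral_const, probReal_univ,
      one_smul]
    linarith
  have := hmin.second_deriv_nonneg
    (fun t => (hC.hasDerivAt_line a w t).add (hasDerivAt_integral_exp _ w t))
    ((hC.hasDerivAt_fderiv_line a w 0).add (hasDerivAt_integral_mul_exp _ w 0))
  simp only [zero_smul, add_zero, zero_mul, Real.exp_zero, mul_one] at this
  linarith

end SecondOrder

/-! ### Norm and eigenvalues of a symmetric bilinear form. -/

section Spectrum

variable {E : Type*} [NormedAddCommGroup E] [InnerProductSpace ℝ E]

/-- The eigenvalues of a bilinear form with respect to the inner product. -/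
def bilinEigenvalues (B : E →L[ℝ] E →L[ℝ] ℝ) : Set ℝ :=
  {l | ∃ v : E, v ≠ 0 ∧ ∀ w, B v w = l * inner ℝ v w}

lemma abs_le_norm_of_mem_bilinEigenvalues {B : E →L[ℝ] E →L[ℝ] ℝ} {l : ℝ}
    (hl : l ∈ bilinEigenvalues B) : |l| ≤ ‖B‖ := by
  obtain ⟨v, hv, h⟩ := hl
  have h1 := B.le_opNorm₂ v v
  rw [h v, real_inner_self_eq_norm_sq, Real.norm_eq_abs, abs_mul, abs_of_nonneg (sq_nonneg ‖v‖),
    mul_assoc, ← sq] at h1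
  exact le_of_mul_le_mul_right h1 (by positivity)

variable [FiniteDimensional ℝ E]

/-- Riesz representation turns B into a symmetric operator T, which is diagonal in an orthonormal
eigenbasis; Parseval then bounds ‖T v‖. -/
lemma norm_le_of_bilinEigenvalues {B : E →L[ℝ] E →L[ℝ] ℝ} (hB : ∀ v w, B v w = B w v)
    {C : ℝ} (hC : 0 ≤ C) (h : ∀ l ∈ bilinEigenvalues B, |l| ≤ C) : ‖B‖ ≤ C := by
  let T : E →ₗ[ℝ] E :=
    { toFun := fun v => (InnerProductSpace.toDual ℝ E).symm (B v)
      map_add' := fun v w => by simp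
      map_smul' := fun c v => by simp }
  have hT : ∀ v w, inner ℝ (T v) w = B v w := fun v w =>
    InnerProductSpace.toDual_symm_apply
  have hsymm : T.IsSymmetric := fun v w => by
    rw [hT, real_inner_comm, hT, hB]
  have hn : Module.finrank ℝ E = Module.finrank ℝ E := rfl
  set b := hsymm.eigenvectorBasis hn
  have hev : ∀ i, |hsymm.eigenvalues hn i| ≤ C := fun i => by
    refine h _ ⟨b i, fun h0 => ?_, fun w => ?_⟩
    · have := b.orthonormal.1 i
      rw [h0, norm_zero] at this
      norm_num at this
    · rw [← hT, hsymm.apply_eigenvectorBasis hn i, inner_smul_left]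
      simp [b]
  have hcoord : ∀ v i, inner ℝ (b i) (T v) = hsymm.eigenvalues hn i * inner ℝ (b i) v := by
    intro v i
    rw [← hsymm (b i) v, hsymm.apply_eigenvectorBasis hn i, inner_smul_left]
    simp [b]
  have hTn : ∀ v, ‖T v‖ ≤ C * ‖v‖ := fun v => by
    refine (pow_le_pow_iff_left₀ (norm_nonneg _) (by positivity) two_ne_zero).1 ?_
    rw [mul_pow, ← b.sum_sq_norm_inner_right (T v), ← b.sum_sq_norm_inner_right v,
      Finset.mul_sum]
    refine Finset.sum_le_sum fun i _ => ?_
    rw [hcoord, norm_mul, mul_pow]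
    exact mul_le_mul_of_nonneg_right (pow_le_pow_left₀ (norm_nonneg _) (hev i) 2) (sq_nonneg _)
  refine B.opNorm_le_bound₂ hC fun v w => ?_
  rw [← hT]
  exact (norm_inner_le_norm _ _).trans (mul_le_mul_of_nonneg_right (hTn v) (norm_nonneg _))

/-- For a symmetric bilinear form, the largest absolute value of an eigenvalue is the norm. -/
lemma max_sSup_neg_sInf_bilinEigenvalues {B : E →L[ℝ] E →L[ℝ] ℝ} (hB : ∀ v w, B v w = B w v) :
    max (sSup (bilinEigenvalues B)) (-sInf (bilinEigenvalues B)) = ‖B‖ := by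
  have habs : ∀ l ∈ bilinEigenvalues B, |l| ≤ ‖B‖ := fun l hl =>
    abs_le_norm_of_mem_bilinEigenvalues hl
  have hab : BddAbove (bilinEigenvalues B) := ⟨‖B‖, fun l hl => (abs_le.1 (habs l hl)).2⟩
  have hbe : BddBelow (bilinEigenvalues B) := ⟨-‖B‖, fun l hl => (abs_le.1 (habs l hl)).1⟩
  refine le_antisymm (max_le ?_ ?_) ?_
  · exact Real.sSup_le (fun l hl => (abs_le.1 (habs l hl)).2) (norm_nonneg B)
  · rw [neg_le]
    exact Real.le_sInf (fun l hl => (abs_le.1 (habs l hl)).1) (neg_nonpos.2 (norm_nonneg B))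
  · refine norm_le_of_bilinEigenvalues hB ?_ fun l hl => ?_
    -- Without eigenvalues (the zero-dimensional case) `sSup` and `sInf` take their default value 0,
    -- which agrees with the norm.
    · rcases (bilinEigenvalues B).eq_empty_or_nonempty with h | ⟨l, hl⟩
      · simp [h]
      · have h1 := le_csSup hab hl
        have h2 := csInf_le hbe hl
        rcases le_total 0 (sSup (bilinEigenvalues B)) with h3 | h3
        · exact le_max_of_le_left h3
        · exact le_max_of_le_right (by linarith)
    · refine abs_le.2 ⟨?_, le_max_of_le_left (le_csSup hab hl)⟩
      rw [neg_le]
      exact le_max_of_le_right (neg_le_neg (csInf_le hbe hl))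

end Spectrum

/-! ### From Hessian bounds to the smoothness constant on a ball. -/

section Hessian

variable {d₀ d₁ : ℕ} {f : FrobMatrix d₀ d₁ → ℝ}

lemma hessianEigenvalues_eq (f : FrobMatrix d₀ d₁ → ℝ) (A : FrobMatrix d₀ d₁) :
    hessianEigenvalues f A = bilinEigenvalues (fderiv ℝ (fderiv ℝ f) A) := rfl

lemma ContDiff.max_hessianEigenvalue_eq_norm (hf : ContDiff ℝ 2 f) (A : FrobMatrix d₀ d₁) :
    max (hessianMaxEigenvalue f A) (-hessianMinEigenvalue f A) =
      ‖fderiv ℝ (fderiv ℝ f) A‖ := by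
  rw [hessianMaxEigenvalue, hessianMinEigenvalue, hessianEigenvalues_eq]
  refine max_sSup_neg_sInf_bilinEigenvalues fun v w => ?_
  have : IsSymmSndFDerivAt ℝ f A := hf.contDiffAt.isSymmSndFDerivAt (by simp)
  exact this v w

lemma convex_frobBall (M : ℝ) : Convex ℝ (frobBall d₀ d₁ M) := by
  have : frobBall d₀ d₁ M = Metric.closedBall 0 (M / 2) := by
    ext A; simp [frobBall]
  rw [this]
  exact convex_closedBall _ _

lemma isCompact_frobBall (M : ℝ) : IsCompact (frobBall d₀ d₁ M) := by
  have : frobBall d₀ d₁ M = Metric.closedBall 0 (M / 2) := by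
    ext A; simp [frobBall]
  rw [this]
  exact isCompact_closedBall _ _

/-- The Riesz isometry transfers the mean value inequality for the derivative to the gradient. -/
lemma ContDiff.lSmoothOn (hf : ContDiff ℝ 2 f) {s : Set (FrobMatrix d₀ d₁)} (hs : Convex ℝ s)
    {L : ℝ} (hL : ∀ A ∈ s, ‖fderiv ℝ (fderiv ℝ f) A‖ ≤ L) : LSmoothOn L f s := by
  have h2 : ContDiff ℝ 1 (fderiv ℝ f) := hf.fderiv_right (by norm_num)
  refine ⟨fun A _ => (hf.differentiable (by norm_num)) A, fun A hA B hB => ?_⟩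
  rw [gradient, gradient, ← map_sub, LinearIsometryEquiv.norm_map]
  exact hs.norm_image_sub_le_of_norm_fderiv_le
    (fun C _ => (h2.differentiable (by norm_num)) C) hL hB hA

/-- The maximum over the ball of the largest absolute Hessian eigenvalue is attained and is a
Lipschitz constant of the gradient. -/
lemma ContDiff.exists_isGreatest_lSmoothOn (hf : ContDiff ℝ 2 f) {m K : ℝ} (hK : 0 ≤ K)
    (h1 : ∀ A B, fderiv ℝ (fderiv ℝ f) A B B ≤ K * ‖B‖ ^ 2)
    (h2 : ∀ A B, m * ‖B‖ ^ 2 ≤ fderiv ℝ (fderiv ℝ f) A B B) {M : ℝ} (hM : 0 < M) :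
    ∃ L : ℝ, IsGreatest ((fun A => max (hessianMaxEigenvalue f A)
        (-hessianMinEigenvalue f A)) '' frobBall d₀ d₁ M) L ∧
      LSmoothOn L f (frobBall d₀ d₁ M) ∧ L ≤ max K (-m) := by
  have hcont : Continuous fun A => ‖fderiv ℝ (fderiv ℝ f) A‖ := by
    have h2 : ContDiff ℝ 1 (fderiv ℝ f) := hf.fderiv_right (by norm_num)
    exact (h2.continuous_fderiv (by norm_num)).norm
  have hne : (frobBall d₀ d₁ M).Nonempty := ⟨0, by simp [frobBall]; positivity⟩
  obtain ⟨A₀, hA₀, hmax⟩ := (isCompact_frobBall M).exists_isMaxOn hne hcont.continuousOn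
  have hle : ∀ A ∈ frobBall d₀ d₁ M, ‖fderiv ℝ (fderiv ℝ f) A‖ ≤ ‖fderiv ℝ (fderiv ℝ f) A₀‖ :=
    fun A hA => hmax hA
  refine ⟨‖fderiv ℝ (fderiv ℝ f) A₀‖, ⟨⟨A₀, hA₀, hf.max_hessianEigenvalue_eq_norm A₀⟩, ?_⟩,
    hf.lSmoothOn (convex_frobBall M) hle, ?_⟩
  · rintro _ ⟨A, hA, rfl⟩
    simp only
    rw [hf.max_hessianEigenvalue_eq_norm]
    exact hle A hA
  · have hpos : 0 ≤ max K (-m) := le_max_of_le_left hK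
    have hsymm : IsSymmSndFDerivAt ℝ f A₀ := hf.contDiffAt.isSymmSndFDerivAt (by simp)
    refine norm_le_of_bilinEigenvalues hsymm hpos ?_
    -- Testing the eigenvalue equation on B itself places l between m and K.
    rintro l ⟨B, hB, h⟩
    have hB2 : 0 < ‖B‖ ^ 2 := by positivity
    have e := h B
    rw [real_inner_self_eq_norm_sq] at e
    have t1 : l ≤ K := le_of_mul_le_mul_right (e ▸ h1 A₀ B) hB2
    have t2 : m ≤ l := le_of_mul_le_mul_right (e ▸ h2 A₀ B) hB2
    refine abs_le.2 ⟨?_, t1.trans (le_max_left _ _)⟩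
    rw [neg_le]
    exact (neg_le_neg t2).trans (le_max_right _ _)

end Hessian

/-! ### Radial clamping, which makes the cost bounded and fixes points of norm at most R. -/

section Clamp

variable {E : Type*} [NormedAddCommGroup E] [NormedSpace ℝ E]

/-- Radial clamping of a normed space to the closed ball of radius `R`. -/
noncomputable def radialClamp (R : ℝ) (x : E) : E := (R / max R ‖x‖) • x

lemma continuous_radialClamp {R : ℝ} (hR : 0 < R) : Continuous (radialClamp R : E → E) :=
  (continuous_const.div (by fun_prop) fun x => (lt_max_of_lt_left hR).ne').smul continuous_id

lemma norm_radialClamp_le {R : ℝ} (hR : 0 < R) (x : E) : ‖radialClamp R x‖ ≤ R := by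
  have h : 0 < max R ‖x‖ := lt_max_of_lt_left hR
  rw [radialClamp, norm_smul, Real.norm_of_nonneg (by positivity), div_mul_eq_mul_div,
    div_le_iff₀ h]
  exact mul_le_mul_of_nonneg_left (le_max_right _ _) hR.le

lemma radialClamp_of_norm_le {R : ℝ} (hR : 0 < R) {x : E} (hx : ‖x‖ ≤ R) :
    radialClamp R x = x := by
  rw [radialClamp, max_eq_left hx, div_self hR.ne', one_smul]

end Clamp

/-! ### Cauchy–Schwarz for a coupling. -/

section CauchySchwarz

variable {X Y : Type*} [TopologicalSpace X] [TopologicalSpace Y]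
  [SecondCountableTopology X] [SecondCountableTopology Y]
  [MeasurableSpace X] [MeasurableSpace Y] [BorelSpace X] [BorelSpace Y]
  {μ : Measure X} {ν : Measure Y} [IsProbabilityMeasure μ] [IsProbabilityMeasure ν]

lemma BoundedContinuousFunction.integrable_sq (π : Measure X) [IsFiniteMeasure π] (f : X →ᵇ ℝ) :
    Integrable (fun x => f x ^ 2) π :=
  (f ^ 2).integrable π

lemma BoundedContinuousFunction.integrable_mul_of_prod (π : Measure (X × Y)) [IsFiniteMeasure π]
    (f : X →ᵇ ℝ) (g : Y →ᵇ ℝ) : Integrable (fun z : X × Y => f z.1 * g z.2) π :=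
  (f.compContinuous ⟨Prod.fst, continuous_fst⟩ *
    g.compContinuous ⟨Prod.snd, continuous_snd⟩).integrable π

lemma integral_mul_le_sqrt_of_mem_couplings {π : Measure (X × Y)} (hπ : π ∈ couplings μ ν)
    (f : X →ᵇ ℝ) (g : Y →ᵇ ℝ) :
    ∫ z, f z.1 * g z.2 ∂π ≤ √((∫ x, f x ^ 2 ∂μ) * ∫ y, g y ^ 2 ∂ν) := by
  have := isProbabilityMeasure_of_mem_couplings hπ
  let F : X × Y →ᵇ ℝ := f.compContinuous ⟨Prod.fst, continuous_fst⟩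
  let G : X × Y →ᵇ ℝ := g.compContinuous ⟨Prod.snd, continuous_snd⟩
  have hF : ∫ x, f x ^ 2 ∂μ = ∫ z, F z ^ 2 ∂π :=
    (integral_fst_of_mem_couplings hπ (f := fun x => f x ^ 2) (by fun_prop)).symm
  have hG : ∫ y, g y ^ 2 ∂ν = ∫ z, G z ^ 2 ∂π :=
    (integral_snd_of_mem_couplings hπ (f := fun y => g y ^ 2) (by fun_prop)).symm
  have i1 : Integrable (fun z => F z ^ 2) π := F.integrable_sq π
  have i2 : Integrable (fun z => F z * G z) π := integrable_mul_of_prod π f g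
  have i3 : Integrable (fun z => G z ^ 2) π := G.integrable_sq π
  have key : ∀ t : ℝ, 0 ≤ (∫ z, G z ^ 2 ∂π) * (t * t) + (-2 * ∫ z, F z * G z ∂π) * t +
      ∫ z, F z ^ 2 ∂π := fun t => by
    have h0 : 0 ≤ ∫ z, (F z - t * G z) ^ 2 ∂π := integral_nonneg fun z => sq_nonneg _
    have e : ∀ z, (F z - t * G z) ^ 2 = (t * t) * G z ^ 2 + (-2 * t) * (F z * G z) + F z ^ 2 :=
      fun z => by ring
    simp_rw [e] at h0
    rw [integral_add (f := fun z => (t * t) * G z ^ 2 + (-2 * t) * (F z * G z))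
      ((i3.const_mul _).add (i2.const_mul _)) i1, integral_add (i3.const_mul _) (i2.const_mul _),
      integral_const_mul, integral_const_mul] at h0
    linarith
  -- The quadratic t ↦ ∫(F - tG)² dπ is nonnegative, so its discriminant is nonpositive.
  have hd := discrim_le_zero key
  rw [discrim] at hd
  rw [hF, hG]
  refine (le_abs_self _).trans (Real.abs_le_sqrt ?_)
  change (∫ z, F z * G z ∂π) ^ 2 ≤ _
  nlinarith

end CauchySchwarz

/-! ### The clamped cost as an affine family of bounded kernels. -/

section Cost

variable {d₀ d₁ : ℕ}

/-- The sum is the Frobenius inner product of A with the rank-one matrix xyᵀ, whose norm is ‖x‖‖y‖.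
-/
lemma abs_sum_mul_le (A : FrobMatrix d₀ d₁) (x : EuclideanSpace ℝ (Fin d₀))
    (y : EuclideanSpace ℝ (Fin d₁)) :
    |∑ i, ∑ j, x i * A (i, j) * y j| ≤ ‖A‖ * (‖x‖ * ‖y‖) := by
  let T : FrobMatrix d₀ d₁ := WithLp.toLp 2 fun p => x p.1 * y p.2
  have hT : ‖T‖ = ‖x‖ * ‖y‖ := by
    rw [EuclideanSpace.norm_eq, EuclideanSpace.norm_eq, EuclideanSpace.norm_eq,
      ← Real.sqrt_mul (Finset.sum_nonneg fun _ _ => sq_nonneg _), Finset.sum_mul_sum,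
      Fintype.sum_prod_type]
    simp [T, mul_pow]
  have hi : ∑ i, ∑ j, x i * A (i, j) * y j = inner ℝ A T := by
    rw [PiLp.inner_apply, Fintype.sum_prod_type]
    refine Finset.sum_congr rfl fun i _ => Finset.sum_congr rfl fun j _ => ?_
    simp [T]
    ring
  rw [hi, ← hT]
  exact abs_real_inner_le_norm A T

/-- The bilinear part of the negated clamped cost, as a linear function of the matrix. -/
noncomputable def clampedBilinear (ε : ℝ) {R : ℝ} (hR : 0 < R) :
    FrobMatrix d₀ d₁ →ₗ[ℝ] (EuclideanSpace ℝ (Fin d₀) × EuclideanSpace ℝ (Fin d₁) →ᵇ ℝ) where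
  toFun A := BoundedContinuousFunction.ofNormedAddCommGroup
    (fun z => 32 * ε⁻¹ * ∑ i, ∑ j, radialClamp R z.1 i * A (i, j) * radialClamp R z.2 j)
    (by
      have h1 := (continuous_radialClamp hR).comp
        (continuous_fst (X := EuclideanSpace ℝ (Fin d₀)) (Y := EuclideanSpace ℝ (Fin d₁)))
      have h2 := (continuous_radialClamp hR).comp
        (continuous_snd (X := EuclideanSpace ℝ (Fin d₀)) (Y := EuclideanSpace ℝ (Fin d₁)))
      refine continuous_const.mul (continuous_finsetSum _ fun i _ =>
        continuous_finsetSum _ fun j _ => ?_)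
      exact (((EuclideanSpace.proj i).continuous.comp h1).mul continuous_const).mul
        ((EuclideanSpace.proj j).continuous.comp h2))
    (|32 * ε⁻¹| * (‖A‖ * (R * R)))
    (fun z => by
      rw [norm_mul, Real.norm_eq_abs, Real.norm_eq_abs]
      refine mul_le_mul_of_nonneg_left ((abs_sum_mul_le _ _ _).trans ?_) (abs_nonneg _)
      exact mul_le_mul_of_nonneg_left (mul_le_mul (norm_radialClamp_le hR _)
        (norm_radialClamp_le hR _) (norm_nonneg _) hR.le) (norm_nonneg _))
  map_add' A B := by
    ext z
    simp [mul_add, add_mul, Finset.sum_add_distrib]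
  map_smul' c A := by
    ext z
    simp only [PiLp.smul_apply, smul_eq_mul, coe_ofNormedAddCommGroup, RingHom.id_apply,
      BoundedContinuousFunction.coe_smul, Finset.mul_sum]
    refine Finset.sum_congr rfl fun i _ => Finset.sum_congr rfl fun j _ => ?_
    ring

/-- The square of the norm of the clamped vector, as a bounded continuous function. -/
noncomputable def clampedNormSq (d : ℕ) {R : ℝ} (hR : 0 < R) : EuclideanSpace ℝ (Fin d) →ᵇ ℝ :=
  BoundedContinuousFunction.ofNormedAddCommGroup (fun x => ‖radialClamp R x‖ ^ 2)
    ((continuous_radialClamp hR).norm.pow 2) (R ^ 2) fun x => by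
      rw [norm_pow, norm_norm]
      exact pow_le_pow_left₀ (norm_nonneg _) (norm_radialClamp_le hR x) 2

/-- The negated clamped cost `-c_A / ε`. -/
noncomputable def clampedKernel (ε : ℝ) {R : ℝ} (hR : 0 < R) (A : FrobMatrix d₀ d₁) :
    EuclideanSpace ℝ (Fin d₀) × EuclideanSpace ℝ (Fin d₁) →ᵇ ℝ :=
  (4 * ε⁻¹) • ((clampedNormSq d₀ hR).compContinuous ⟨Prod.fst, continuous_fst⟩ *
    (clampedNormSq d₁ hR).compContinuous ⟨Prod.snd, continuous_snd⟩) +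
    LinearMap.toContinuousLinearMap (clampedBilinear ε hR) A

/-- Lines of matrices become lines of kernels, so the second derivative of the composite involves
only that of `dualValue`. -/
lemma clampedKernel_add_smul (ε : ℝ) {R : ℝ} (hR : 0 < R) (A B : FrobMatrix d₀ d₁) (t : ℝ) :
    clampedKernel ε hR (A + t • B) =
      clampedKernel ε hR A + t • LinearMap.toContinuousLinearMap (clampedBilinear ε hR) B := by
  simp only [clampedKernel, map_add, map_smul, add_assoc]

lemma costMatrix_eq_clampedKernel {ε : ℝ} (hε : 0 < ε) {R : ℝ} (hR : 0 < R)
    (A : FrobMatrix d₀ d₁) {x : EuclideanSpace ℝ (Fin d₀)} {y : EuclideanSpace ℝ (Fin d₁)}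
    (hx : ‖x‖ ≤ R) (hy : ‖y‖ ≤ R) : costMatrix A x y = -ε * clampedKernel ε hR A (x, y) := by
  simp only [clampedKernel, clampedBilinear, clampedNormSq, costMatrix,
    BoundedContinuousFunction.add_apply, BoundedContinuousFunction.coe_smul,
    BoundedContinuousFunction.mul_apply, compContinuous_apply, ContinuousMap.coe_mk,
    coe_ofNormedAddCommGroup, LinearMap.coe_toContinuousLinearMap', LinearMap.coe_mk,
    AddHom.coe_mk, radialClamp_of_norm_le hR hx, radialClamp_of_norm_le hR hy, smul_eq_mul]
  field_simp
  ring

lemma clampedBilinear_sq_le (ε : ℝ) {R : ℝ} (hR : 0 < R) (B : FrobMatrix d₀ d₁)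
    (z : EuclideanSpace ℝ (Fin d₀) × EuclideanSpace ℝ (Fin d₁)) :
    clampedBilinear ε hR B z ^ 2 ≤
      (32 * ε⁻¹) ^ 2 * ‖B‖ ^ 2 * (clampedNormSq d₀ hR z.1 * clampedNormSq d₁ hR z.2) := by
  have h := abs_sum_mul_le B (radialClamp R z.1) (radialClamp R z.2)
  have h2 := pow_le_pow_left₀ (abs_nonneg _) h 2
  rw [sq_abs] at h2
  simp only [clampedBilinear, clampedNormSq, coe_ofNormedAddCommGroup, LinearMap.coe_mk,
    AddHom.coe_mk]
  rw [mul_pow]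
  calc _ ≤ (32 * ε⁻¹) ^ 2 * (‖B‖ * (‖radialClamp R z.1‖ * ‖radialClamp R z.2‖)) ^ 2 :=
        mul_le_mul_of_nonneg_left h2 (sq_nonneg _)
    _ = _ := by ring

lemma integral_clampedNormSq_sq {d : ℕ} {μ : Measure (EuclideanSpace ℝ (Fin d))} {R : ℝ}
    (hR : 0 < R) (h : ∀ᵐ x ∂μ, ‖x‖ ≤ R) :
    ∫ x, clampedNormSq d hR x ^ 2 ∂μ = fourthMoment μ := by
  refine integral_congr_ae ?_
  filter_upwards [h] with x hx
  simp only [clampedNormSq, coe_ofNormedAddCommGroup, radialClamp_of_norm_le hR hx]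
  ring

end Cost

/-! ### Regularity, Hessian bounds and coercivity of the objective. -/

section Objective

variable {d₀ d₁ : ℕ} {μ₀ : Measure (EuclideanSpace ℝ (Fin d₀))}
  {μ₁ : Measure (EuclideanSpace ℝ (Fin d₁))}
  [IsProbabilityMeasure μ₀] [IsProbabilityMeasure μ₁]

lemma exists_ae_norm_le_of_isCompact_support {d : ℕ} {μ : Measure (EuclideanSpace ℝ (Fin d))}
    (h : IsCompact μ.support) : ∃ R : ℝ, ∀ R' ≥ R, ∀ᵐ x ∂μ, ‖x‖ ≤ R' := by
  obtain ⟨R, hR⟩ := h.isBounded.exists_norm_le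
  refine ⟨R, fun R' hR' => ?_⟩
  filter_upwards [Measure.support_mem_ae (μ := μ)] with x hx using (hR x hx).trans hR'

variable {ε R : ℝ}

lemma matrixOT_eq (hε : 0 < ε) (hR : 0 < R) (h₀ : ∀ᵐ x ∂μ₀, ‖x‖ ≤ R) (h₁ : ∀ᵐ y ∂μ₁, ‖y‖ ≤ R)
    (A : FrobMatrix d₀ d₁) :
    matrixOT ε μ₀ μ₁ A = ((ε * dualValue μ₀ μ₁ (clampedKernel ε hR A) : ℝ) : EReal) :=
  entropicOT_eq_dualValue hε (S := {x | ‖x‖ ≤ R}) (T := {y | ‖y‖ ≤ R}) h₀ h₁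
    fun _ hx _ hy => costMatrix_eq_clampedKernel hε hR A hx hy

lemma objective_eq (hε : 0 < ε) (hR : 0 < R) (h₀ : ∀ᵐ x ∂μ₀, ‖x‖ ≤ R) (h₁ : ∀ᵐ y ∂μ₁, ‖y‖ ≤ R) :
    objective ε μ₀ μ₁ = fun A : FrobMatrix d₀ d₁ =>
      32 * ‖A‖ ^ 2 + ε * dualValue μ₀ μ₁ (clampedKernel ε hR A) := by
  funext A
  rw [objective, matrixOT_eq hε hR h₀ h₁, EReal.toReal_coe]

lemma contDiff_objective (hε : 0 < ε) (hR : 0 < R) (h₀ : ∀ᵐ x ∂μ₀, ‖x‖ ≤ R)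
    (h₁ : ∀ᵐ y ∂μ₁, ‖y‖ ≤ R) : ContDiff ℝ 2 (objective (d₀ := d₀) (d₁ := d₁) ε μ₀ μ₁) := by
  rw [objective_eq hε hR h₀ h₁]
  have h1 : ContDiff ℝ 2 (dualValue μ₀ μ₁) := contDiff_dualValue μ₀ μ₁ (n := 2) (by norm_num)
  have h2 : ContDiff ℝ 2 (clampedKernel (d₀ := d₀) (d₁ := d₁) ε hR) :=
    contDiff_const.add (ContinuousLinearMap.contDiff _)
  exact (contDiff_const.mul (contDiff_norm_sq ℝ)).add (contDiff_const.mul (h1.comp h2))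

lemma second_fderiv_objective (hε : 0 < ε) (hR : 0 < R) (h₀ : ∀ᵐ x ∂μ₀, ‖x‖ ≤ R)
    (h₁ : ∀ᵐ y ∂μ₁, ‖y‖ ≤ R) (A B : FrobMatrix d₀ d₁) :
    fderiv ℝ (fderiv ℝ (objective ε μ₀ μ₁)) A B B = 64 * ‖B‖ ^ 2 +
      ε * fderiv ℝ (fderiv ℝ (dualValue μ₀ μ₁)) (clampedKernel ε hR A)
        (clampedBilinear ε hR B) (clampedBilinear ε hR B) := by
  have hC := contDiff_objective (d₀ := d₀) (d₁ := d₁) hε hR h₀ h₁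
  have hV : ContDiff ℝ 2 (dualValue μ₀ μ₁) := contDiff_dualValue μ₀ μ₁ (n := 2) (by norm_num)
  have e1 : (fun t : ℝ => fderiv ℝ (objective ε μ₀ μ₁) (A + t • B) B) = fun t : ℝ =>
      32 * (2 * inner ℝ (A + t • B) B) + ε * fderiv ℝ (dualValue μ₀ μ₁)
        (clampedKernel ε hR A + t • clampedBilinear ε hR B) (clampedBilinear ε hR B) := by
    funext t
    refine (hC.hasDerivAt_line A B t).unique ?_
    have e : (fun t : ℝ => objective ε μ₀ μ₁ (A + t • B)) = fun t : ℝ =>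
        32 * ‖A + t • B‖ ^ 2 + ε * dualValue μ₀ μ₁
          (clampedKernel ε hR A + t • clampedBilinear ε hR B) := by
      funext t
      rw [objective_eq hε hR h₀ h₁]
      simp only
      rw [clampedKernel_add_smul]
      rfl
    rw [e]
    exact ((hasDerivAt_norm_sq_line A B t).const_mul 32).add
      ((hV.hasDerivAt_line _ _ t).const_mul ε)
  have h1 := hC.hasDerivAt_fderiv_line A B 0
  rw [e1] at h1
  have h2 := h1.unique (((hasDerivAt_inner_line A B 0).const_mul 32).add
    ((hV.hasDerivAt_fderiv_line (clampedKernel ε hR A) (clampedBilinear ε hR B) 0).const_mul ε))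
  simp only [zero_smul, add_zero] at h2
  rw [h2]
  ring

lemma second_fderiv_objective_le (hε : 0 < ε) (hR : 0 < R) (h₀ : ∀ᵐ x ∂μ₀, ‖x‖ ≤ R)
    (h₁ : ∀ᵐ y ∂μ₁, ‖y‖ ≤ R) (A B : FrobMatrix d₀ d₁) :
    fderiv ℝ (fderiv ℝ (objective ε μ₀ μ₁)) A B B ≤ 64 * ‖B‖ ^ 2 := by
  rw [second_fderiv_objective hε hR h₀ h₁]
  obtain ⟨φ, ψ, h⟩ := exists_isSchrodingerPair μ₀ μ₁ (clampedKernel ε hR A)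
  have := mul_nonpos_of_nonneg_of_nonpos hε.le
    (h.second_fderiv_dualValue_nonpos (clampedBilinear ε hR B))
  linarith

/-- The plan enters only through its marginals: Cauchy–Schwarz applied to ‖x‖²‖y‖² produces the
fourth moments, and ε(32ε⁻¹)² = 32²ε⁻¹ is the constant. -/
lemma le_second_fderiv_objective (hε : 0 < ε) (hR : 0 < R) (h₀ : ∀ᵐ x ∂μ₀, ‖x‖ ≤ R)
    (h₁ : ∀ᵐ y ∂μ₁, ‖y‖ ≤ R) (A B : FrobMatrix d₀ d₁) :
    -(32 ^ 2 * ε⁻¹ * √(fourthMoment μ₀ * fourthMoment μ₁) - 64) * ‖B‖ ^ 2 ≤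
      fderiv ℝ (fderiv ℝ (objective ε μ₀ μ₁)) A B B := by
  rw [second_fderiv_objective hε hR h₀ h₁]
  obtain ⟨φ, ψ, h⟩ := exists_isSchrodingerPair μ₀ μ₁ (clampedKernel ε hR A)
  have hp := h.isProbabilityMeasure_plan
  have h2 := h.neg_integral_sq_le_second_fderiv_dualValue (clampedBilinear ε hR B)
  set π := schrodingerPlan μ₀ μ₁ (clampedKernel ε hR A) φ ψ
  have h3 : ∫ z, clampedBilinear ε hR B z ^ 2 ∂π ≤
      (32 * ε⁻¹) ^ 2 * ‖B‖ ^ 2 * √(fourthMoment μ₀ * fourthMoment μ₁) := by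
    have hcs := integral_mul_le_sqrt_of_mem_couplings h.plan_mem_couplings
      (clampedNormSq d₀ hR) (clampedNormSq d₁ hR)
    rw [integral_clampedNormSq_sq hR h₀, integral_clampedNormSq_sq hR h₁] at hcs
    refine le_trans ?_ (mul_le_mul_of_nonneg_left hcs (by positivity))
    rw [← integral_const_mul]
    have i1 : Integrable (fun z : EuclideanSpace ℝ (Fin d₀) × EuclideanSpace ℝ (Fin d₁) =>
        clampedNormSq d₀ hR z.1 * clampedNormSq d₁ hR z.2) π :=
      integrable_mul_of_prod π _ _
    exact integral_mono ((clampedBilinear ε hR B).integrable_sq π) (i1.const_mul _)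
      fun z => clampedBilinear_sq_le ε hR B z
  have h4 := mul_le_mul_of_nonneg_left ((neg_le_neg h3).trans h2) hε.le
  have h5 : ε * -((32 * ε⁻¹) ^ 2 * ‖B‖ ^ 2 * √(fourthMoment μ₀ * fourthMoment μ₁)) =
      -(32 ^ 2 * ε⁻¹ * √(fourthMoment μ₀ * fourthMoment μ₁)) * ‖B‖ ^ 2 := by
    field_simp
  rw [h5] at h4
  linarith

lemma ContDiff.weaklyConvex {f : FrobMatrix d₀ d₁ → ℝ} (hf : ContDiff ℝ 2 f) {ρ : ℝ}
    (h : ∀ A B, -ρ * ‖B‖ ^ 2 ≤ fderiv ℝ (fderiv ℝ f) A B B) : WeaklyConvex ρ f := by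
  refine convexOn_univ_of_line_deriv2_nonneg
    (D₁ := fun A B => fderiv ℝ f A B + ρ / 2 * (2 * Inner.inner ℝ A B))
    (D₂ := fun A B => fderiv ℝ (fderiv ℝ f) A B B + ρ / 2 * (2 * ‖B‖ ^ 2)) ?_ ?_ ?_
  · exact fun A B t => (hf.hasDerivAt_line A B t).add
      ((hasDerivAt_norm_sq_line A B t).const_mul _)
  · exact fun A B t => (hf.hasDerivAt_fderiv_line A B t).add
      ((hasDerivAt_inner_line A B t).const_mul _)
  · intro A B
    linarith [h A B]

lemma WeaklyConvex.strictConvexOn {f : FrobMatrix d₀ d₁ → ℝ} {ρ : ℝ} (h : WeaklyConvex ρ f)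
    (hρ : ρ < 0) : StrictConvexOn ℝ univ f := by
  have hs : StrongConvexOn univ (-ρ) f := by
    rw [strongConvexOn_iff_convex]
    have e : (fun A => f A - -ρ / 2 * ‖A‖ ^ 2) = fun A => f A + ρ / 2 * ‖A‖ ^ 2 := by
      funext A; ring
    rw [e]
    exact h
  exact hs.strictConvexOn (by linarith)

/-- The dual value is at least -‖a‖, and the kernel a grows at most linearly in A, so the quadratic
term dominates. -/
lemma tendsto_objective_cocompact (hε : 0 < ε) (hR : 0 < R) (h₀ : ∀ᵐ x ∂μ₀, ‖x‖ ≤ R)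
    (h₁ : ∀ᵐ y ∂μ₁, ‖y‖ ≤ R) :
    Tendsto (objective (d₀ := d₀) (d₁ := d₁) ε μ₀ μ₁) (cocompact _) atTop := by
  set ℓ := LinearMap.toContinuousLinearMap (clampedBilinear (d₀ := d₀) (d₁ := d₁) ε hR)
  set C := ‖clampedKernel ε hR (0 : FrobMatrix d₀ d₁)‖
  have hle : ∀ A : FrobMatrix d₀ d₁, ‖A‖ * (32 * ‖A‖ - ε * ‖ℓ‖) - ε * C ≤
      objective ε μ₀ μ₁ A := fun A => by
    have h1 := neg_norm_le_dualValue (μ := μ₀) (ν := μ₁) (clampedKernel ε hR A)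
    have h2 : clampedKernel ε hR A = clampedKernel ε hR (0 : FrobMatrix d₀ d₁) + ℓ A := by
      have := clampedKernel_add_smul ε hR 0 A 1
      rwa [one_smul, one_smul, zero_add] at this
    have h3 : ‖clampedKernel ε hR A‖ ≤ C + ‖ℓ‖ * ‖A‖ := by
      rw [h2]
      exact (norm_add_le _ _).trans (add_le_add_right (ℓ.le_opNorm A) _)
    have h4 := mul_le_mul_of_nonneg_left ((neg_le_neg h3).trans h1) hε.le
    rw [objective_eq hε hR h₀ h₁]
    simp only
    nlinarith
  refine tendsto_atTop_mono hle (tendsto_atTop_add_const_right _ _ ?_)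
  have hn : Tendsto (fun A : FrobMatrix d₀ d₁ => ‖A‖) (cocompact _) atTop :=
    tendsto_norm_cocompact_atTop
  exact hn.atTop_mul_atTop₀ (tendsto_atTop_add_const_right _ _ (hn.const_mul_atTop (by norm_num)))

end Objective

theorem theorem1 (d₀ d₁ : ℕ)
    (μ₀ : Measure (EuclideanSpace ℝ (Fin d₀))) (μ₁ : Measure (EuclideanSpace ℝ (Fin d₁)))
    [IsProbabilityMeasure μ₀] [IsProbabilityMeasure μ₁]
    (hμ₀ : IsCompact μ₀.support) (hμ₁ : IsCompact μ₁.support)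
    (ε : ℝ) (hε : 0 < ε) :
    -- `Φ` is real-valued and twice continuously differentiable
    (∀ A, matrixOT ε μ₀ μ₁ A ≠ ⊤ ∧ matrixOT ε μ₀ μ₁ A ≠ ⊥) ∧
    ContDiff ℝ 2 (objective ε μ₀ μ₁) ∧
    WeaklyConvex (32 ^ 2 * ε⁻¹ * √(fourthMoment μ₀ * fourthMoment μ₁) - 64)
      (objective ε μ₀ μ₁) ∧
    (√(fourthMoment μ₀ * fourthMoment μ₁) < ε / 16 →
      StrictConvexOn ℝ univ (objective ε μ₀ μ₁) ∧
      ∃! A, ∀ B, objective ε μ₀ μ₁ A ≤ objective ε μ₀ μ₁ B) ∧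
    ∀ M : ℝ, 0 < M → ∃ L : ℝ,
      IsGreatest ((fun A => max (hessianMaxEigenvalue (objective ε μ₀ μ₁) A)
        (-hessianMinEigenvalue (objective ε μ₀ μ₁) A)) '' frobBall d₀ d₁ M) L ∧
      LSmoothOn L (objective ε μ₀ μ₁) (frobBall d₀ d₁ M) ∧
      L ≤ max 64 (32 ^ 2 * ε⁻¹ * √(fourthMoment μ₀ * fourthMoment μ₁) - 64) := by
  obtain ⟨R₀, hR₀⟩ := exists_ae_norm_le_of_isCompact_support hμ₀
  obtain ⟨R₁, hR₁⟩ := exists_ae_norm_le_of_isCompact_support hμ₁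
  -- One radius for both measures; the 1 ensures positivity, since R₀ and R₁ may be nonpositive.
  set R := max 1 (max R₀ R₁)
  have hR : 0 < R := lt_max_of_lt_left one_pos
  have h₀ := hR₀ R ((le_max_left _ _).trans (le_max_right _ _))
  have h₁ := hR₁ R ((le_max_right _ _).trans (le_max_right _ _))
  have hC := contDiff_objective (d₀ := d₀) (d₁ := d₁) hε hR h₀ h₁
  have hlow := le_second_fderiv_objective (d₀ := d₀) (d₁ := d₁) hε hR h₀ h₁
  have hW := hC.weaklyConvex hlow
  refine ⟨fun A => ?_, hC, hW, fun hsmall => ?_, fun M hM => ?_⟩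
  · rw [matrixOT_eq hε hR h₀ h₁]
    exact ⟨EReal.coe_ne_top _, EReal.coe_ne_bot _⟩
  -- The threshold ε/16 is where ρ vanishes, since 32²/16 = 64; below it Φ is strongly convex.
  · have hρ : 32 ^ 2 * ε⁻¹ * √(fourthMoment μ₀ * fourthMoment μ₁) - 64 < 0 := by
      have h1 := mul_lt_mul_of_pos_left hsmall (show 0 < 32 ^ 2 * ε⁻¹ by positivity)
      have h2 : 32 ^ 2 * ε⁻¹ * (ε / 16) = 64 := by field_simp; norm_num
      linarith
    have hS := hW.strictConvexOn hρ
    obtain ⟨A, hA⟩ := hC.continuous.exists_forall_le (tendsto_objective_cocompact hε hR h₀ h₁)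
    refine ⟨hS, A, hA, fun B hB => ?_⟩
    exact hS.eq_of_isMinOn (fun C _ => hB C) (fun C _ => hA C) (mem_univ _) (mem_univ _)
  · have := hC.exists_isGreatest_lSmoothOn (by norm_num : (0 : ℝ) ≤ 64)
      (second_fderiv_objective_le hε hR h₀ h₁) hlow hM
    simpa only [neg_neg] using this
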